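/- Let $\mathcal A$ be an abelian category and let $(\mathcal T,\mathcal F)$ be a torsion pair on $\mathcal A$: $\mathcal T$ and $\mathcal F$ are full subcategories closed under direct summands, $\operatorname{Hom}_{\mathcal A}(T,F)=0$ for all $T\in\mathcal T$ and $F\in\mathcal F$, and each object $X$ of $\mathcal A$ fits into a short exact sequence $0\to T\to X\to F\to 0$ with $T\in\mathcal T$ and $F\in\mathcal F$. Assume that the torsion pair is tilting, that is, each object of $\mathcal A$ embeds into an object of $\mathcal T$. Let $\mathcal B$ be the full subcategory of the (unbounded) derived category $D(\mathcal A)$ consisting of the complexes $X$ with $H^0(X)\in\mathcal T$, $H^{-1}(X)\in\mathcal F$ and $H^i(X)=0$ for $i\neq 0,-1$; it is the heart of a t-structure on $D(\mathcal A)$, hence an abelian category. Then there is an equivalence of triangulated categories $\Phi\colon D(\mathcal B)\to D(\mathcal A)$ such that the composite $\mathcal B\hookrightarrow D(\mathcal B)\xrightarrow{\Phi}D(\mathcal A)$, where the first functor sends an object to the corresponding complex concentrated in degree $0$, is naturally isomorphic to the inclusion $\mathcal B\hookrightarrow D(\mathcal A)$. Moreover, for each $*\in\{+,-,b\}$ there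 is an equivalence of triangulated categories $\Phi^*\colon D^*(\mathcal B)\to D^*(\mathcal A)$ which is, up to natural isomorphism, the restriction of $\Phi$, and such that the composite $\mathcal B\hookrightarrow D^*(\mathcal B)\xrightarrow{\Phi^*}D^*(\mathcal A)\hookrightarrow D(\mathcal A)$ is naturally isomorphic to the inclusion $\mathcal B\hookrightarrow D(\mathcal A)$. -/

import Mathlib

universe w w' v u

open CategoryTheory CategoryTheory.Limits CategoryTheory.Pretriangulated
  CategoryTheory.Triangulated

/-- The heart of a t-structure is stable under finite products. -/
theorem heart_isClosedUnderFiniteProducts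
    {C : Type u} [Category.{v} C] [Preadditive C] [HasZeroObject C] [HasShift C ℤ]
    [∀ (n : ℤ), (shiftFunctor C n).Additive] [Pretriangulated C] (t : TStructure C) :
    t.heart.IsClosedUnderFiniteProducts := by
  have : t.heart.IsClosedUnderBinaryProducts :=
    { limitsOfShape_le := by
        rintro X ⟨p⟩
        refine t.heart.prop_of_iso
          (IsLimit.conePointUniqueUpToIso (prodIsProd _ _)
            ((IsLimit.postcomposeHomEquiv (diagramIsoPair p.diag) _).2 p.isLimit)) ?_
        have h₁ := (t.mem_heart_iff _).1 (p.prop_diag_obj (.mk .left))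
        have h₂ := (t.mem_heart_iff _).1 (p.prop_diag_obj (.mk .right))
        exact (t.mem_heart_iff _).2
          ⟨t.isLE₂ _ (binaryProductTriangle_distinguished _ _) 0 h₁.1 h₂.1,
            t.isGE₂ _ (binaryProductTriangle_distinguished _ _) 0 h₁.2 h₂.2⟩ }
  have : t.heart.ContainsZero :=
    ⟨⟨_, isZero_zero C, (t.mem_heart_iff _).2
      ⟨t.isLE_of_isZero (isZero_zero C) 0, t.isGE_of_isZero (isZero_zero C) 0⟩⟩⟩
  exact .mk'

/-- The heart of a t-structure on a triangulated category is an abelian category. -/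
noncomputable abbrev heartAbelian
    {C : Type u} [Category.{v} C] [Preadditive C] [HasZeroObject C] [HasShift C ℤ]
    [∀ (n : ℤ), (shiftFunctor C n).Additive] [Pretriangulated C] [IsTriangulated C]
    (t : TStructure C) (P : ObjectProperty C) (hP : P = t.heart) :
    Abelian P.FullSubcategory := by
  have hP' (X : C) : P X ↔ t.IsLE X 0 ∧ t.IsGE X 0 := by rw [hP, t.mem_heart_iff]
  have : P.IsClosedUnderFiniteProducts := hP ▸ heart_isClosedUnderFiniteProducts t
  have hι : ∀ ⦃X Y : P.FullSubcategory⦄ ⦃n : ℤ⦄ (f : P.ι.obj X ⟶ (P.ι.obj Y)⟦n⟧),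
      n < 0 → f = 0 := by
    intro X Y n f hn
    have : t.IsLE (P.ι.obj X) 0 := ((hP' _).1 X.2).1
    have : t.IsGE ((P.ι.obj Y)⟦n⟧) (-n) :=
      have : t.IsGE (P.ι.obj Y) 0 := ((hP' _).1 Y.2).2
      t.isGE_shift _ 0 n (-n) (by lia)
    exact t.zero f 0 (-n) (by lia)
  refine AbelianSubcategory.abelian P.ι hι ?_
  ext X₁ X₂ f₁
  simp only [MorphismProperty.top_apply, iff_true]
  intro X₃ f₂ f₃ hT
  have h₁ := (hP' _).1 X₁.2
  have h₂ := (hP' _).1 X₂.2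
  have hle : t.IsLE X₃ 0 :=
    t.isLE₂ _ (rot_of_distTriang _ hT) 0 h₂.1 (by
      have : t.IsLE (P.ι.obj X₁) 0 := h₁.1
      have : t.IsLE ((P.ι.obj X₁)⟦(1 : ℤ)⟧) (-1) := t.isLE_shift _ 0 1 (-1) (by lia)
      exact t.isLE_of_le ((P.ι.obj X₁)⟦(1 : ℤ)⟧) (-1) 0)
  have hge : t.IsGE X₃ (-1) :=
    t.isGE₂ _ (rot_of_distTriang _ hT) (-1) (by
      have : t.IsGE (P.ι.obj X₂) 0 := h₂.2
      exact t.isGE_of_ge (P.ι.obj X₂) (-1) 0) (by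
      have : t.IsGE (P.ι.obj X₁) 0 := h₁.2
      exact t.isGE_shift (P.ι.obj X₁) 0 1 (-1) (by lia))
  obtain ⟨A, B, hA, hB, α, β, γ, hT'⟩ := t.exists_triangle X₃ (-1) 0 (by lia)
  have hA₁ : t.IsLE A (-1) := ⟨hA⟩
  have hB₁ : t.IsGE B 0 := ⟨hB⟩
  have hA₂ : t.IsGE A (-1) :=
    t.isGE₂ _ (inv_rot_of_distTriang _ hT') (-1) (by
      have : t.IsGE (B⟦(-1 : ℤ)⟧) 1 := t.isGE_shift _ 0 (-1) 1 (by lia)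
      exact t.isGE_of_ge (B⟦(-1 : ℤ)⟧) (-1) 1) hge
  have hB₂ : t.IsLE B 0 :=
    t.isLE₂ _ (rot_of_distTriang _ hT') 0 hle (by
      have : t.IsLE (A⟦(1 : ℤ)⟧) (-2) := t.isLE_shift _ (-1) 1 (-2) (by lia)
      exact t.isLE_of_le (A⟦(1 : ℤ)⟧) (-2) 0)
  let K : P.FullSubcategory := ⟨A⟦(-1 : ℤ)⟧, (hP' _).2
    ⟨t.isLE_shift _ (-1) (-1) 0 (by lia), t.isGE_shift _ (-1) (-1) 0 (by lia)⟩⟩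
  let Q : P.FullSubcategory := ⟨B, (hP' _).2 ⟨hB₂, hB₁⟩⟩
  let e : (P.ι.obj K)⟦(1 : ℤ)⟧ ≅ A := (shiftEquiv C (1 : ℤ)).counitIso.app A
  refine ⟨K, Q, e.hom ≫ α, β, γ ≫ e.inv⟦(1 : ℤ)⟧', ?_⟩
  refine isomorphic_distinguished _ hT' _ ?_
  refine Triangle.isoMk _ _ e (Iso.refl _) (Iso.refl _) ?_ ?_ ?_
  · exact Category.comp_id _
  · exact (Category.comp_id _).trans (Category.id_comp _).symm
  · have he : e.inv⟦(1 : ℤ)⟧' ≫ e.hom⟦(1 : ℤ)⟧' = 𝟙 (A⟦(1 : ℤ)⟧) := by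
      rw [← Functor.map_comp, e.inv_hom_id, CategoryTheory.Functor.map_id]
    refine (Category.assoc _ _ _).trans (Eq.trans ?_ (Category.id_comp _).symm)
    exact (congrArg (γ ≫ ·) he).trans (Category.comp_id γ)

/-- A torsion pair on an abelian category `A`: two full subcategories closed under direct
summands, without nonzero morphisms from the first to the second, such that each object is an
extension of an object of the second by an object of the first. -/
structure TorsionPair (A : Type u) [Category.{v} A] [Abelian A] where
  /-- the torsion objects -/
  T : ObjectProperty A
  /-- the torsion-free objects -/
  F : ObjectProperty A
  hom_eq_zero : ∀ ⦃X Y : A⦄, T X → F Y → ∀ f : X ⟶ Y, f = 0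
  retract_T : T.IsStableUnderRetracts
  retract_F : F.IsStableUnderRetracts
  exists_shortExact : ∀ X : A, ∃ (X' X'' : A) (i : X' ⟶ X) (p : X ⟶ X'') (w : i ≫ p = 0),
    T X' ∧ F X'' ∧ (ShortComplex.mk i p w).ShortExact

namespace TorsionPair

/-- A torsion pair is tilting if each object embeds into a torsion object. -/
def IsTilting {A : Type u} [Category.{v} A] [Abelian A] (τ : TorsionPair A) : Prop :=
  ∀ X : A, ∃ (Y : A) (i : X ⟶ Y), τ.T Y ∧ Mono i

/-- The property of objects `X` of `D(A)` such that `H⁰(X)` is torsion, `H⁻¹(X)` is torsion-free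
and `Hⁱ(X) = 0` for all other `i`. -/
def heart {A : Type u} [Category.{v} A] [Abelian A] [HasDerivedCategory.{w} A]
    (τ : TorsionPair A) : ObjectProperty (DerivedCategory A) := fun X =>
  τ.T ((DerivedCategory.homologyFunctor A 0).obj X) ∧
  τ.F ((DerivedCategory.homologyFunctor A (-1)).obj X) ∧
  ∀ i : ℤ, i ≠ 0 → i ≠ -1 → IsZero ((DerivedCategory.homologyFunctor A i).obj X)

/-- The tilted category `B`: the full subcategory of `D(A)` on the objects of `τ.heart`. -/
abbrev Heart {A : Type u} [Category.{v} A] [Abelian A] [HasDerivedCategory.{w} A]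
    (τ : TorsionPair A) : Type (max u v) := τ.heart.FullSubcategory

section

variable {A : Type u} [Category.{v} A] [Abelian A] (τ : TorsionPair A)

theorem T_of_hom_eq_zero {X : A} (h : ∀ ⦃Y : A⦄, τ.F Y → ∀ f : X ⟶ Y, f = 0) : τ.T X := by
  obtain ⟨X', X'', i, p, w, h', h'', hS⟩ := τ.exists_shortExact X
  have := hS.mono_f
  have := hS.epi_g
  have hi : Epi i := hS.exact.epi_f (h h'' p)
  have : IsIso i := isIso_of_mono_of_epi i
  have := τ.retract_T
  exact τ.T.prop_of_retract { i := inv i, r := i } h'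

theorem F_of_hom_eq_zero {Y : A} (h : ∀ ⦃X : A⦄, τ.T X → ∀ f : X ⟶ Y, f = 0) : τ.F Y := by
  obtain ⟨X', X'', i, p, w, h', h'', hS⟩ := τ.exists_shortExact Y
  have := hS.mono_f
  have := hS.epi_g
  have hi : Mono p := hS.exact.mono_g (h h' i)
  have : IsIso p := isIso_of_mono_of_epi p
  have := τ.retract_F
  exact τ.F.prop_of_retract { i := p, r := inv p } h''

theorem T_of_iso {X Y : A} (e : X ≅ Y) (hX : τ.T X) : τ.T Y :=
  have := τ.retract_T
  τ.T.prop_of_retract { i := e.inv, r := e.hom } hX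

theorem F_of_iso {X Y : A} (e : X ≅ Y) (hX : τ.F X) : τ.F Y :=
  have := τ.retract_F
  τ.F.prop_of_retract { i := e.inv, r := e.hom } hX

theorem T_of_isZero {X : A} (hX : IsZero X) : τ.T X :=
  τ.T_of_hom_eq_zero (fun _ _ f => hX.eq_of_src f 0)

theorem F_of_isZero {X : A} (hX : IsZero X) : τ.F X :=
  τ.F_of_hom_eq_zero (fun _ _ f => hX.eq_of_tgt f 0)

variable [HasDerivedCategory.{w} A]

theorem isZero_homology₂ (T : Triangle (DerivedCategory A)) (hT : T ∈ distTriang _) (n : ℤ)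
    (h₁ : IsZero ((DerivedCategory.homologyFunctor A n).obj T.obj₁))
    (h₃ : IsZero ((DerivedCategory.homologyFunctor A n).obj T.obj₃)) :
    IsZero ((DerivedCategory.homologyFunctor A n).obj T.obj₂) :=
  (DerivedCategory.HomologySequence.exact₂ T hT n).isZero_of_both_isZero h₁ h₃

theorem isIso_homology_mor₂ (T : Triangle (DerivedCategory A)) (hT : T ∈ distTriang _)
    (n m : ℤ) (h : n + 1 = m)
    (h₀ : IsZero ((DerivedCategory.homologyFunctor A n).obj T.obj₁))
    (h₁ : IsZero ((DerivedCategory.homologyFunctor A m).obj T.obj₁)) :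
    IsIso ((DerivedCategory.homologyFunctor A n).map T.mor₂) := by
  have := (DerivedCategory.HomologySequence.mono_homologyMap_mor₂_iff T hT n).2 (h₀.eq_of_src _ _)
  have := (DerivedCategory.HomologySequence.epi_homologyMap_mor₂_iff T hT n m h).2
    (h₁.eq_of_tgt _ _)
  exact isIso_of_mono_of_epi _

theorem isIso_homology_mor₁ (T : Triangle (DerivedCategory A)) (hT : T ∈ distTriang _)
    (m n : ℤ) (h : m + 1 = n)
    (h₀ : IsZero ((DerivedCategory.homologyFunctor A m).obj T.obj₃))
    (h₁ : IsZero ((DerivedCategory.homologyFunctor A n).obj T.obj₃)) :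
    IsIso ((DerivedCategory.homologyFunctor A n).map T.mor₁) := by
  have := (DerivedCategory.HomologySequence.epi_homologyMap_mor₁_iff T hT n).2 (h₁.eq_of_tgt _ _)
  have := (DerivedCategory.HomologySequence.mono_homologyMap_mor₁_iff T hT m n h).2
    (h₀.eq_of_src _ _)
  exact isIso_of_mono_of_epi _

theorem isLE_shift_one (X : DerivedCategory A) (n m : ℤ) (h : n ≤ m + 1) [X.IsLE n] :
    (X⟦(1 : ℤ)⟧).IsLE m := by
  have := DerivedCategory.TStructure.t.isLE_shift X n 1 (n - 1) (by lia)
  exact DerivedCategory.TStructure.t.isLE_of_le _ (n - 1) m (by lia)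

/-- `Hⁱ(X[a])` is isomorphic to `Hʲ(X)` for `j = a + i`. -/
noncomputable def homologyShiftIso (X : DerivedCategory A) (a i j : ℤ) (h : a + i = j) :
    (DerivedCategory.homologyFunctor A i).obj (X⟦a⟧) ≅
      (DerivedCategory.homologyFunctor A j).obj X :=
  ((DerivedCategory.homologyFunctor A 0).shiftIso a i j h).app X

/-- The aisle of the tilted t-structure in degree `n`. -/
def tiltedLE (n : ℤ) : ObjectProperty (DerivedCategory A) := fun X =>
  τ.T ((DerivedCategory.homologyFunctor A n).obj X) ∧
  ∀ i : ℤ, n < i → IsZero ((DerivedCategory.homologyFunctor A i).obj X)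

/-- The coaisle of the tilted t-structure in degree `n`. -/
def tiltedGE (n : ℤ) : ObjectProperty (DerivedCategory A) := fun X =>
  τ.F ((DerivedCategory.homologyFunctor A (n - 1)).obj X) ∧
  ∀ i : ℤ, i < n - 1 → IsZero ((DerivedCategory.homologyFunctor A i).obj X)

theorem tilted_zero ⦃X Y : DerivedCategory A⦄ (f : X ⟶ Y) (hX : τ.tiltedLE 0 X)
    (hY : τ.tiltedGE 1 Y) : f = 0 := by
  have hX₀ : X.IsLE 0 := (DerivedCategory.isLE_iff X 0).2 hX.2
  have hY₀ : Y.IsGE 0 := (DerivedCategory.isGE_iff Y 0).2 (by simpa using hY.2)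
  have hY₁ : τ.F ((DerivedCategory.homologyFunctor A 0).obj Y) := by simpa using hY.1
  obtain ⟨X', X'', hX', hX'', i, p, d, hd⟩ :=
    DerivedCategory.TStructure.t.exists_triangle X (-1) 0 (by lia)
  have hX'₀ : X'.IsLE (-1) := ⟨hX'⟩
  have hX''₀ : X''.IsGE 0 := ⟨hX''⟩
  have hX''₁ : X''.IsLE 0 := DerivedCategory.TStructure.t.isLE₂ _ (rot_of_distTriang _ hd) 0 hX₀
    (isLE_shift_one X' (-1) 0 (by lia))
  obtain ⟨Y', Y'', hY', hY'', j, q, δ, hδ⟩ :=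
    DerivedCategory.TStructure.t.exists_triangle Y 0 1 (by lia)
  have hY'₀ : Y'.IsLE 0 := ⟨hY'⟩
  have hY''₀ : Y''.IsGE 1 := ⟨hY''⟩
  have hY'₁ : Y'.IsGE 0 := DerivedCategory.TStructure.t.isGE₂ _ (inv_rot_of_distTriang _ hδ) 0 (by
      have : (Y''⟦(-1 : ℤ)⟧).IsGE 2 :=
        DerivedCategory.TStructure.t.isGE_shift _ 1 (-1) 2 (by lia)
      exact DerivedCategory.TStructure.t.isGE_of_ge (Y''⟦(-1 : ℤ)⟧) 0 2) hY₀
  obtain ⟨g, hg⟩ : ∃ g : X'' ⟶ Y, f = p ≫ g := Triangle.yoneda_exact₂ _ hd f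
    (DerivedCategory.TStructure.t.zero (i ≫ f) (-1) 0 (by lia))
  obtain ⟨k, hk⟩ : ∃ k : X'' ⟶ Y', g = k ≫ j := Triangle.coyoneda_exact₂ _ hδ g
    (DerivedCategory.TStructure.t.zero (g ≫ q) 0 1 (by lia))
  obtain ⟨M, ⟨eM⟩⟩ := DerivedCategory.exists_iso_singleFunctor_obj_of_isGE_of_isLE X'' 0
  obtain ⟨N, ⟨eN⟩⟩ := DerivedCategory.exists_iso_singleFunctor_obj_of_isGE_of_isLE Y' 0
  obtain ⟨φ, hφ⟩ := (DerivedCategory.singleFunctor A 0).map_surjective (eM.inv ≫ k ≫ eN.hom)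
  have hp : IsIso ((DerivedCategory.homologyFunctor A 0).map p) :=
    isIso_homology_mor₂ _ hd 0 1 (by lia) (X'.isZero_of_isLE (-1) 0 (by lia))
      (X'.isZero_of_isLE (-1) 1 (by lia))
  have hj : IsIso ((DerivedCategory.homologyFunctor A 0).map j) :=
    isIso_homology_mor₁ _ hδ (-1) 0 (by lia) (Y''.isZero_of_isGE 1 (-1) (by lia))
      (Y''.isZero_of_isGE 1 0 (by lia))
  have hM : τ.T M := τ.T_of_iso
    (asIso ((DerivedCategory.homologyFunctor A 0).map p) ≪≫
      (DerivedCategory.homologyFunctor A 0).mapIso eM ≪≫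
      (DerivedCategory.singleFunctorCompHomologyFunctorIso A 0).app M) hX.1
  have hN : τ.F N := τ.F_of_iso
    ((asIso ((DerivedCategory.homologyFunctor A 0).map j)).symm ≪≫
      (DerivedCategory.homologyFunctor A 0).mapIso eN ≪≫
      (DerivedCategory.singleFunctorCompHomologyFunctorIso A 0).app N) hY₁
  have hk₀ : k = 0 := by
    rw [τ.hom_eq_zero hM hN φ, Functor.map_zero] at hφ
    rw [← cancel_epi eM.inv, ← cancel_mono eN.hom, Category.assoc, ← hφ, comp_zero, zero_comp]
  rw [hg, hk, hk₀, zero_comp, comp_zero]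

theorem tilted_exists_triangle (X : DerivedCategory A) :
    ∃ (X' X'' : DerivedCategory A) (_ : τ.tiltedLE 0 X') (_ : τ.tiltedGE 1 X'')
      (f : X' ⟶ X) (g : X ⟶ X'') (h : X'' ⟶ X'⟦(1 : ℤ)⟧), Triangle.mk f g h ∈ distTriang _ := by
  obtain ⟨P, R, hP', hR', i, p, d, hd⟩ :=
    DerivedCategory.TStructure.t.exists_triangle X 0 1 (by lia)
  have hP : P.IsLE 0 := ⟨hP'⟩
  have hR : R.IsGE 1 := ⟨hR'⟩
  obtain ⟨Y', Y, hY', hY, j, q, δ, hδ⟩ :=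
    DerivedCategory.TStructure.t.exists_triangle P (-1) 0 (by lia)
  have hY'₀ : Y'.IsLE (-1) := ⟨hY'⟩
  have hY₀ : Y.IsGE 0 := ⟨hY⟩
  have hY₁ : Y.IsLE 0 :=
    DerivedCategory.TStructure.t.isLE₂ _ (rot_of_distTriang _ hδ) 0 hP
      (isLE_shift_one Y' (-1) 0 (by lia))
  obtain ⟨M, ⟨eM⟩⟩ := DerivedCategory.exists_iso_singleFunctor_obj_of_isGE_of_isLE Y 0
  obtain ⟨M', M'', a, b, w, hM', hM'', hS⟩ := τ.exists_shortExact M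
  have := hS.mono_f
  have := hS.epi_g
  dsimp at this
  have hq : IsIso ((DerivedCategory.homologyFunctor A 0).map q) :=
    isIso_homology_mor₂ _ hδ 0 1 (by lia) (Y'.isZero_of_isLE (-1) 0 (by lia))
      (Y'.isZero_of_isLE (-1) 1 (by lia))
  let σ := DerivedCategory.singleFunctorCompHomologyFunctorIso A 0
  let θ : (DerivedCategory.homologyFunctor A 0).obj P ≅ M :=
    asIso ((DerivedCategory.homologyFunctor A 0).map q) ≪≫
      (DerivedCategory.homologyFunctor A 0).mapIso eM ≪≫ σ.app M
  let φ : P ⟶ (DerivedCategory.singleFunctor A 0).obj M'' :=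
    q ≫ eM.hom ≫ (DerivedCategory.singleFunctor A 0).map b
  have hφ : (DerivedCategory.homologyFunctor A 0).map φ ≫ σ.hom.app M'' = θ.hom ≫ b := by
    have := σ.hom.naturality b
    simp only [Functor.comp_map, Functor.id_map] at this
    simp [φ, θ, this]
  have hφ' : (DerivedCategory.homologyFunctor A 0).map φ = θ.hom ≫ b ≫ σ.inv.app M'' := by
    rw [← Category.assoc, ← hφ, Category.assoc, Iso.hom_inv_id_app]
    exact (Category.comp_id _).symm
  have hφ_epi : Epi ((DerivedCategory.homologyFunctor A 0).map φ) := by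
    rw [hφ']
    infer_instance
  obtain ⟨Z, u, v, hu⟩ := distinguished_cocone_triangle₁ φ
  obtain ⟨W, r, s, hr⟩ := distinguished_cocone_triangle (u ≫ i)
  have hZ₁ : IsZero ((DerivedCategory.homologyFunctor A 1).obj Z) := by
    refine (DerivedCategory.HomologySequence.exact₁ _ hu 0 1 (by lia)).isZero_X₂ ?_ ?_
    · exact (DerivedCategory.HomologySequence.epi_homologyMap_mor₂_iff _ hu 0 1 (by lia)).1 hφ_epi
    · exact (P.isZero_of_isLE 0 1 (by lia)).eq_of_tgt _ _
  have hu_mono : Mono ((DerivedCategory.homologyFunctor A 0).map u) :=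
    (DerivedCategory.HomologySequence.mono_homologyMap_mor₁_iff _ hu (-1) 0 (by lia)).2
      ((((DerivedCategory.singleFunctor A 0).obj M'').isZero_of_isGE 0 (-1)
        (by lia)).eq_of_src _ _)
  have hex := DerivedCategory.HomologySequence.exact₂ _ hu 0
  have huφ : (DerivedCategory.homologyFunctor A 0).map u ≫
      (DerivedCategory.homologyFunctor A 0).map φ = 0 :=
    ((DerivedCategory.homologyFunctor A 0).map_comp u φ).symm.trans
      ((congrArg _ (comp_distTriang_mor_zero₁₂ _ hu)).trans (Functor.map_zero _ _ _))
  have hum : ((DerivedCategory.homologyFunctor A 0).map u ≫ θ.hom) ≫ b = 0 := by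
    rw [Category.assoc, ← hφ, reassoc_of% huφ, zero_comp]
  have hal : (a ≫ θ.inv) ≫ (DerivedCategory.homologyFunctor A 0).map φ = 0 := by
    rw [hφ', Category.assoc, Iso.inv_hom_id_assoc, reassoc_of% w, zero_comp]
  have ha : Mono a := hS.mono_f
  obtain ⟨m, hm⟩ : ∃ m : (DerivedCategory.homologyFunctor A 0).obj Z ⟶ M',
      m ≫ a = (DerivedCategory.homologyFunctor A 0).map u ≫ θ.hom := ⟨_, hS.exact.lift_f _ hum⟩
  obtain ⟨l, hl⟩ : ∃ l : M' ⟶ (DerivedCategory.homologyFunctor A 0).obj Z,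
      l ≫ (DerivedCategory.homologyFunctor A 0).map u = a ≫ θ.inv := by
    have : Mono (ShortComplex.mk _ _ huφ).f := hu_mono
    exact ⟨_, ShortComplex.Exact.lift_f (S := ShortComplex.mk _ _ huφ) hex _ hal⟩
  have hZ₀ : τ.T ((DerivedCategory.homologyFunctor A 0).obj Z) := τ.T_of_iso
    { hom := l
      inv := m
      hom_inv_id := by
        rw [← cancel_mono a, Category.assoc, hm, reassoc_of% hl]
        simp
      inv_hom_id := by
        rw [← cancel_mono ((DerivedCategory.homologyFunctor A 0).map u), Category.assoc, hl,
          reassoc_of% hm]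
        simp } hM'
  have hZ : τ.tiltedLE 0 Z := by
    refine ⟨hZ₀, fun k hk => ?_⟩
    obtain rfl | hk' : k = 1 ∨ 1 < k := by lia
    · exact hZ₁
    · refine (DerivedCategory.HomologySequence.exact₁ _ hu (k - 1) k (by lia)).isZero_X₂ ?_ ?_
      · exact (((DerivedCategory.singleFunctor A 0).obj M'').isZero_of_isLE 0 (k - 1)
          (by lia)).eq_of_src _ _
      · exact (P.isZero_of_isLE 0 k (by lia)).eq_of_tgt _ _
  let O := someOctahedron rfl hu hd hr
  have hW : W.IsGE 0 := DerivedCategory.TStructure.t.isGE₂ _ O.mem 0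
    (inferInstanceAs (((DerivedCategory.singleFunctor A 0).obj M'').IsGE 0))
    (DerivedCategory.TStructure.t.isGE_of_ge R 0 1 (by lia))
  have hm₁ : Mono ((DerivedCategory.homologyFunctor A 0).map O.m₁) :=
    (DerivedCategory.HomologySequence.mono_homologyMap_mor₁_iff _ O.mem (-1) 0 (by lia)).2
      ((R.isZero_of_isGE 1 (-1) (by lia)).eq_of_src _ _)
  have hm₂ : Epi ((DerivedCategory.homologyFunctor A 0).map O.m₁) :=
    (DerivedCategory.HomologySequence.epi_homologyMap_mor₁_iff _ O.mem 0).2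
      ((R.isZero_of_isGE 1 0 (by lia)).eq_of_tgt _ _)
  have hm₃ : IsIso ((DerivedCategory.homologyFunctor A 0).map O.m₁) := isIso_of_mono_of_epi _
  have hW₀ : τ.F ((DerivedCategory.homologyFunctor A 0).obj W) := τ.F_of_iso
    ((σ.app M'').symm ≪≫ asIso ((DerivedCategory.homologyFunctor A 0).map O.m₁)) hM''
  exact ⟨Z, W, hZ, ⟨by simpa using hW₀, fun k hk => W.isZero_of_isGE 0 k (by lia)⟩,
    u ≫ i, r, s, hr⟩

/-- The tilted t-structure on `D(A)` attached to a torsion pair on `A`. -/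
noncomputable def tStructure : TStructure (DerivedCategory A) where
  le := τ.tiltedLE
  ge := τ.tiltedGE
  le_isClosedUnderIsomorphisms n :=
    ⟨fun {X Y} e h => ⟨τ.T_of_iso ((DerivedCategory.homologyFunctor A n).mapIso e) h.1,
      fun i hi => (h.2 i hi).of_iso ((DerivedCategory.homologyFunctor A i).mapIso e.symm)⟩⟩
  ge_isClosedUnderIsomorphisms n :=
    ⟨fun {X Y} e h => ⟨τ.F_of_iso ((DerivedCategory.homologyFunctor A (n - 1)).mapIso e) h.1,
      fun i hi => (h.2 i hi).of_iso ((DerivedCategory.homologyFunctor A i).mapIso e.symm)⟩⟩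
  le_shift n a n' h X hX :=
    ⟨τ.T_of_iso (homologyShiftIso X a n' n h).symm hX.1,
      fun i hi => (hX.2 (a + i) (by lia)).of_iso (homologyShiftIso X a i (a + i) rfl)⟩
  ge_shift n a n' h X hX :=
    ⟨τ.F_of_iso (homologyShiftIso X a (n' - 1) (n - 1) (by lia)).symm hX.1,
      fun i hi => (hX.2 (a + i) (by lia)).of_iso (homologyShiftIso X a i (a + i) rfl)⟩
  zero' := τ.tilted_zero
  le_zero_le X hX := ⟨τ.T_of_isZero (hX.2 1 (by lia)), fun i hi => hX.2 i (by lia)⟩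
  ge_one_le X hX := ⟨τ.F_of_isZero (hX.2 (0 - 1) (by lia)), fun i hi => hX.2 i (by lia)⟩
  exists_triangle_zero_one := τ.tilted_exists_triangle

theorem heart_eq : τ.heart = τ.tStructure.heart := by
  ext X
  constructor
  · rintro ⟨h₁, h₂, h₃⟩
    exact ⟨⟨h₁, fun i hi => h₃ i (by lia) (by lia)⟩,
      ⟨h₂, fun i hi => h₃ i (by lia) (by lia)⟩⟩
  · rintro ⟨⟨h₁, h₂⟩, ⟨h₃, h₄⟩⟩
    refine ⟨h₁, h₃, fun i hi hi' => ?_⟩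
    by_cases h : 0 < i
    · exact h₂ i h
    · exact h₄ i (by lia)

/-- The tilted category `B` is abelian, as it is the heart of a t-structure. Its additive structure
is the one of the full subcategory of `D(A)`. -/
noncomputable instance : Abelian τ.Heart :=
  heartAbelian τ.tStructure τ.heart τ.heart_eq

end

end TorsionPair

namespace DerivedCategory

variable (C : Type u) [Category.{v} C] [Abelian C] [HasDerivedCategory.{w} C]

/-- The inclusion of `C` in `D⁺(C)` as complexes concentrated in degree zero. -/
noncomputable def toPlus : C ⥤ Plus C :=
  TStructure.t.plus.lift (singleFunctor C 0) (fun _ => ⟨0, inferInstance⟩)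

/-- The inclusion of `C` in `D⁻(C)` as complexes concentrated in degree zero. -/
noncomputable def toMinus : C ⥤ Minus C :=
  TStructure.t.minus.lift (singleFunctor C 0) (fun _ => ⟨0, inferInstance⟩)

/-- The inclusion of `C` in `Dᵇ(C)` as complexes concentrated in degree zero. -/
noncomputable def toBounded : C ⥤ Bounded C :=
  TStructure.t.bounded.lift (singleFunctor C 0)
    (fun _ => ⟨⟨0, inferInstance⟩, ⟨0, inferInstance⟩⟩)

end DerivedCategory

/-! Torsion objects sit fully faithfully both in $\mathcal A$ and, as stalk complexes in degree $0$,
in $\mathcal B$. Both derived categories turn out to be the same Verdier quotient of the homotopy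
category $K(\mathcal T)$.

In $\mathcal A$, $\mathcal T$ is closed under quotients and cogenerates, by tilting. Dually, in
$\mathcal B$ it is closed under subobjects and generates (`IsTilting.isResolving_toHeart`): for
$M\in\mathcal B$, embed $H^{-1}(M)$ into a torsion object $Y$ via a map $M\to Y[1]$; its fibre is
torsion and maps onto $M$. Closure under quotients makes resolutions have length one, so any
unbounded complex is resolved in one step: embed it into a contractible complex over $\mathcal T$
and take the cokernel (`CochainComplex.exists_right_resolution` and its dual). Hence $D(\mathcal A)$
and $D(\mathcal B)$ are the quotients of $K(\mathcal T)$ by the complexes acyclic in $\mathcal A$,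
respectively in $\mathcal B$.

These acyclic complexes agree (`IsTilting.acyclic_eq`). On either side an acyclic complex over
$\mathcal T$ splices from short exact sequences in $\mathcal T$, and such a sequence is exact in
$\mathcal A$ if and only if it is exact in $\mathcal B$: both conditions mean that it extends to a
distinguished triangle of $D(\mathcal A)$. This gives $\Phi$.

On $\mathcal B$, $\Phi$ and the inclusion both send short exact sequences to triangles and agree on
$\mathcal T$. As $\operatorname{Hom}(X[1],Y)=0$ in $D(\mathcal A)$ for $X,Y\in\mathcal B$, comparing
cones of presentations by $\mathcal T$ yields a natural isomorphism
(`Functor.IsResolving.nonempty_iso`). Finally, the resolutions enlarge bounds by at most one degree,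
so $\Phi$ matches $D^+$, $D^-$ and $D^b$. -/

namespace CategoryTheory

/-! ### Verdier quotients computed on a subcategory with resolutions -/

section

variable {K H D : Type*} [Category* K] [Category* H] [Category* D]
  [HasZeroObject K] [HasShift K ℤ] [Preadditive K]
  [∀ n : ℤ, (shiftFunctor K n).Additive] [Pretriangulated K]
  [HasZeroObject H] [HasShift H ℤ] [Preadditive H]
  [∀ n : ℤ, (shiftFunctor H n).Additive] [Pretriangulated H]
  (F : K ⥤ H) [F.CommShift ℤ] [F.IsTriangulated] [F.Full] [F.Faithful]
  (B : ObjectProperty H) [B.IsTriangulated] [B.IsClosedUnderIsomorphisms]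
  (L : H ⥤ D) [L.IsLocalization B.trW]

set_option linter.unusedSectionVars false

theorem Functor.essImage_inf_trW {X Y : H} (f : X ⟶ Y) (hX : F.essImage X) (hY : F.essImage Y)
    (hf : B.trW f) : (F.essImage ⊓ B).trW f := by
  obtain ⟨Z, hZ, a, b, hT⟩ := F.essImage.distinguished_cocone_triangle f hX hY
  rw [ObjectProperty.trW_iff]
  exact ⟨Z, a, b, hT, hZ, (B.trW_iff_of_distinguished _ hT).1 hf⟩

theorem Functor.inverseImage_trW_iff {X Y : K} (f : X ⟶ Y) :
    (B.inverseImage F).trW f ↔ B.trW (F.map f) := by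
  constructor
  · rw [ObjectProperty.trW_iff, ObjectProperty.trW_iff]
    rintro ⟨Z, a, b, hT, hZ⟩
    exact ⟨_, _, _, F.map_distinguished _ hT, hZ⟩
  · intro hf
    obtain ⟨Z, a, b, hT⟩ := distinguished_cocone_triangle f
    rw [ObjectProperty.trW_iff]
    exact ⟨Z, a, b, hT, (B.trW_iff_of_distinguished _ (F.map_distinguished _ hT)).1 hf⟩

variable [CategoryTheory.IsTriangulated H]

/-- `F` is an equivalence onto its essential image followed by an inclusion. The inclusion induces a
fully faithful functor on quotients, which `hF` makes essentially surjective; the result is then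
transported along the equivalence. -/
theorem Functor.isLocalization_comp_of_isLocalizedFullyFaithful
    [(F.essImage.triangulatedLocalizerMorphism B).IsLocalizedFullyFaithful]
    (hF : ∀ X : D, ∃ Y : K, Nonempty (L.obj (F.obj Y) ≅ X)) :
    (F ⋙ L).IsLocalization (B.inverseImage F).trW := by
  have : (F.essImage.ι ⋙ L).EssSurj :=
    ⟨fun X => by
      obtain ⟨Y, ⟨e⟩⟩ := hF X
      exact ⟨⟨F.obj Y, F.obj_mem_essImage Y⟩, ⟨e⟩⟩⟩
  have hL : (F.essImage.ι ⋙ L).IsLocalization (B.inverseImage F.essImage.ι).trW :=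
    (F.essImage.triangulatedLocalizerMorphism B).isLocalization_of_isLocalizedFullyFaithful
      (L₂ := L) (F := 𝟭 D) (Functor.rightUnitor _).symm
  have : F.toEssImage.IsEquivalence := { }
  let E := F.toEssImage.asEquivalence.symm
  let e : E.functor ⋙ F ≅ F.essImage.ι :=
    Functor.isoWhiskerLeft _ F.toEssImageCompι.symm ≪≫ (Functor.associator _ _ _).symm ≪≫
      Functor.isoWhiskerRight E.unitIso.symm _ ≪≫ Functor.leftUnitor _
  refine Functor.IsLocalization.of_equivalence_source (F.essImage.ι ⋙ L)
    (B.inverseImage F.essImage.ι).trW _ _ E ?_ ?_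
    ((Functor.associator _ _ _).symm ≪≫ Functor.isoWhiskerRight e L)
  · intro X Y f hf
    refine MorphismProperty.le_isoClosure _ _ ?_
    rw [inverseImage_trW_iff] at hf ⊢
    exact (B.trW.arrow_mk_iso_iff (((Functor.mapArrowFunctor _ _).mapIso e).app (Arrow.mk f))).2 hf
  · intro X Y f hf
    rw [inverseImage_trW_iff] at hf
    exact Localization.inverts L B.trW _ hf

/-- If every object admits a morphism with cone in `B` to an object in the image of `F`, then `F`
identifies the Verdier quotient by `B` as a localization of its source. -/
theorem Functor.isLocalization_comp_of_right_resolutions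
    (hF : ∀ X : H, ∃ (Y : K) (s : X ⟶ F.obj Y), B.trW s) :
    (F ⋙ L).IsLocalization (B.inverseImage F).trW := by
  have : F.essImage.IsVerdierRightLocalizing B := by
    rw [ObjectProperty.isVerdierRightLocalizing_iff]
    intro X Y s hX hs
    obtain ⟨Z, t, ht⟩ := hF Y
    -- Following `s` by a resolution of its target brings the target back into the image of `F`, and
    -- the cone stays in `B`.
    exact ⟨_, s ≫ t, t, F.obj_mem_essImage Z,
      F.essImage_inf_trW B _ hX (F.obj_mem_essImage Z) (B.trW.comp_mem _ _ hs ht), rfl⟩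
  refine F.isLocalization_comp_of_isLocalizedFullyFaithful B L (fun X => ?_)
  have := Localization.essSurj L B.trW
  obtain ⟨Y, s, hs⟩ := hF (L.objPreimage X)
  have := Localization.inverts L B.trW s hs
  exact ⟨Y, ⟨(asIso (L.map s)).symm ≪≫ L.objObjPreimageIso X⟩⟩

/-- If every object admits a morphism with cone in `B` from an object in the image of `F`, then `F`
identifies the Verdier quotient by `B` as a localization of its source. -/
theorem Functor.isLocalization_comp_of_left_resolutions
    (hF : ∀ X : H, ∃ (Y : K) (s : F.obj Y ⟶ X), B.trW s) :
    (F ⋙ L).IsLocalization (B.inverseImage F).trW := by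
  have : F.essImage.IsVerdierLeftLocalizing B := by
    rw [ObjectProperty.isVerdierLeftLocalizing_iff]
    intro X Y s hY hs
    obtain ⟨Z, t, ht⟩ := hF X
    exact ⟨_, t ≫ s, t, F.obj_mem_essImage Z,
      F.essImage_inf_trW B _ (F.obj_mem_essImage Z) hY (B.trW.comp_mem _ _ ht hs), rfl⟩
  refine F.isLocalization_comp_of_isLocalizedFullyFaithful B L (fun X => ?_)
  have := Localization.essSurj L B.trW
  obtain ⟨Y, s, hs⟩ := hF (L.objPreimage X)
  have := Localization.inverts L B.trW s hs
  exact ⟨Y, ⟨asIso (L.map s) ≪≫ L.objObjPreimageIso X⟩⟩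

end

end CategoryTheory

/-! ### One-step resolutions of unbounded complexes -/

namespace CategoryTheory.ObjectProperty

section

variable {H : Type*} [Category* H] [HasZeroObject H] [HasShift H ℤ] [Preadditive H]
  [∀ n : ℤ, (shiftFunctor H n).Additive] [Pretriangulated H] (B : ObjectProperty H)
  [B.IsTriangulated] [B.IsClosedUnderIsomorphisms]

set_option linter.unusedSectionVars false

theorem exists_trW_of_isZero₂ (T : Triangle H) (hT : T ∈ distTriang H) (h : IsZero T.obj₂)
    {Z : H} (q : T.obj₃ ⟶ Z) (hq : B.trW q) : ∃ s : T.obj₁⟦(1 : ℤ)⟧ ⟶ Z, B.trW s := by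
  have : IsIso T.mor₃ := (Triangle.isZero₂_iff_isIso₃ _ hT).1 h
  exact ⟨inv T.mor₃ ≫ q, (B.trW.cancel_left_of_respectsIso _ _).2 hq⟩

theorem exists_trW_of_shift {X Y : H} (s : X⟦(1 : ℤ)⟧ ⟶ Y) (hs : B.trW s) :
    ∃ t : X ⟶ Y⟦(-1 : ℤ)⟧, B.trW t :=
  ⟨(shiftEquiv H (1 : ℤ)).unitIso.hom.app _ ≫ s⟦(-1 : ℤ)⟧',
    (B.trW.cancel_left_of_respectsIso _ _).2 ((MorphismProperty.IsCompatibleWithShift.iff B.trW s (-1 : ℤ)).2 hs)⟩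

end

end CategoryTheory.ObjectProperty

namespace CochainComplex

open HomologicalComplex

section

variable {C : Type*} [Category* C] [Abelian C]

/-- The cochain complex with zero differential on a family of objects. -/
@[simps]
def ofZeroDifferential (T : ℤ → C) : CochainComplex C ℤ where
  X := T
  d _ _ := 0

section

variable (K : CochainComplex C ℤ) {Z : CochainComplex C ℤ} (hZ : ∀ i j, Z.d i j = 0)

/-- The morphism from a complex `K` to the mapping cone of the identity of a complex `Z` with zero
differential which is induced by a family of morphisms from the objects of `K` to those of `Z`. -/
noncomputable def toMappingConeId (i : ∀ n, K.X n ⟶ Z.X n) : K ⟶ mappingCone (𝟙 Z) :=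
  mappingCone.lift _
    -- The components to $Z^{n+1}$ and $Z^n$ are $i\circ d$ and $i$; the first is a cocycle because
    -- $d^2=0$ and $Z$ has zero differential.
    (HomComplex.Cocycle.mk (HomComplex.Cochain.mk (fun p q _ => K.d p q ≫ i q)) 2
      (by lia) (by
        ext p q hpq
        simp [hZ, HomComplex.δ_v 1 2 (by lia) _ p q hpq (p + 1) (p + 1) (by lia) rfl]))
    (HomComplex.Cochain.ofHoms i) (by
      ext p q hpq
      simp [hZ, HomComplex.δ_v 0 1 (by lia) _ p q hpq p q (by lia) (by lia)])

theorem mono_toMappingConeId (i : ∀ n, K.X n ⟶ Z.X n) (hi : ∀ n, Mono (i n)) :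
    Mono (toMappingConeId K hZ i) := by
  refine mono_of_mono_f _ (fun n => ?_)
  have h : (toMappingConeId K hZ i).f n ≫ (mappingCone.snd (𝟙 Z)).v n n (add_zero n) = i n := by
    simp [toMappingConeId]
  have := hi n
  exact mono_of_mono_fac h

/-- The morphism to a complex `K` from the mapping cone of the identity of a complex `Z` with zero
differential which is induced by a family of morphisms from the objects of `Z` to those of `K`. -/
noncomputable def ofMappingConeId (p : ∀ n, Z.X (n + 1) ⟶ K.X n) : mappingCone (𝟙 Z) ⟶ K :=
  mappingCone.desc _
    -- On the summand $Z^{n+1}$ the map is $p$; compatibility with differentials then forces $d\circ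
    -- p$ on $Z^n$.
    (HomComplex.Cochain.mk (fun a b h => (Z.XIsoOfEq (by lia)).hom ≫ p b))
    { f := fun n => (Z.XIsoOfEq (by lia)).hom ≫ p (n - 1) ≫ K.d (n - 1) n
      comm' := by simp [hZ] } (by
      ext n
      simp [hZ, HomComplex.δ_v (-1) 0 (by lia) _ n n (by lia) (n - 1) (n + 1) (by lia) (by lia)])

theorem epi_ofMappingConeId (p : ∀ n, Z.X (n + 1) ⟶ K.X n) (hp : ∀ n, Epi (p n)) :
    Epi (ofMappingConeId K hZ p) := by
  refine epi_of_epi_f _ (fun n => ?_)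
  have h : (mappingCone.inl (𝟙 Z)).v (n + 1) n (by lia) ≫ (ofMappingConeId K hZ p).f n = p n := by
    simp [ofMappingConeId]
  have := hp n
  exact epi_of_epi_fac h

end

theorem isZero_quotient_mappingCone_id (K : CochainComplex C ℤ) :
    IsZero ((HomotopyCategory.quotient C (ComplexShape.up ℤ)).obj (mappingCone (𝟙 K))) := by
  rw [IsZero.iff_id_eq_zero, ← CategoryTheory.Functor.map_id,
    HomotopyCategory.eq_of_homotopy _ _ (mappingCone.homotopyToZeroOfId K), Functor.map_zero]

/-- If the middle term of a short exact sequence of complexes is contractible, then the shift of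
the first term maps quasi-isomorphically to the third term, in the homotopy category. -/
theorem exists_shift_quasiIso {S : ShortComplex (CochainComplex C ℤ)} (hS : S.ShortExact)
    (h : IsZero ((HomotopyCategory.quotient C (ComplexShape.up ℤ)).obj S.X₂)) :
    ∃ s : ((HomotopyCategory.quotient C (ComplexShape.up ℤ)).obj S.X₁)⟦(1 : ℤ)⟧ ⟶
      (HomotopyCategory.quotient C (ComplexShape.up ℤ)).obj S.X₃,
      (HomotopyCategory.subcategoryAcyclic C).trW s := by
  have hT := HomotopyCategory.mappingCone_triangleh_distinguished S.f
  let q : (mappingCone.triangleh S.f).obj₃ ⟶ (HomotopyCategory.quotient C _).obj S.X₃ :=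
    (HomotopyCategory.quotient C (ComplexShape.up ℤ)).map (mappingCone.descShortComplex S)
  have hq : (HomotopyCategory.subcategoryAcyclic C).trW q := by
    rw [← HomotopyCategory.quasiIso_eq_trW_subcategoryAcyclic]
    have := mappingCone.quasiIso_descShortComplex hS
    exact (HomotopyCategory.quotient_map_mem_quasiIso_iff _).2 this
  exact (HomotopyCategory.subcategoryAcyclic C).exists_trW_of_isZero₂ _ hT h q hq

variable (P : ObjectProperty C)

theorem prop_mappingCone_id [P.IsClosedUnderIsomorphisms]
    (hP : ∀ X Y, P X → P Y → P (X ⊞ Y)) {T : ℤ → C} (hT : ∀ n, P (T n)) (n : ℤ) :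
    P ((mappingCone (𝟙 (ofZeroDifferential T))).X n) :=
  P.prop_of_iso (HomologicalComplex.homotopyCofiber.XIsoBiprod (𝟙 (ofZeroDifferential T)) n (n + 1) rfl).symm
    (hP _ _ (hT _) (hT _))

/-- Embed `K` into the contractible cone of the identity of a complex with terms in `P` and zero
differential. The cokernel has terms in `P` by closure under quotients, and its shift by $-1$ is the
resolution. No induction on degrees is needed, hence no boundedness. -/
theorem exists_right_resolution (hP : ∀ X Y, P X → P Y → P (X ⊞ Y))
    (hP' : ∀ ⦃X Y : C⦄ (f : X ⟶ Y) [Epi f], P X → P Y)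
    (h : ∀ X : C, ∃ (Y : C) (i : X ⟶ Y), P Y ∧ Mono i) (K : CochainComplex C ℤ) :
    ∃ (L : CochainComplex C ℤ) (s : (HomotopyCategory.quotient C (ComplexShape.up ℤ)).obj K ⟶
      (HomotopyCategory.quotient C (ComplexShape.up ℤ)).obj L),
      (HomotopyCategory.subcategoryAcyclic C).trW s ∧ (∀ n, P (L.X n)) ∧
      ∀ n, IsZero (K.X (n - 1)) → IsZero (K.X n) → IsZero (L.X n) := by
  have : P.IsClosedUnderIsomorphisms := ⟨fun e hX => hP' e.hom hX⟩
  -- Zero objects are embedded into zero objects, so that the resolution inherits bounds.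
  have h₀ (X : C) : ∃ (Y : C) (i : X ⟶ Y), P Y ∧ Mono i ∧ (IsZero X → IsZero Y) := by
    obtain ⟨Y, i, hY, hi⟩ := h X
    by_cases hX : IsZero X
    · have : Epi (0 : Y ⟶ X) := ⟨fun _ _ _ => hX.eq_of_src _ _⟩
      exact ⟨X, 𝟙 X, hP' (0 : Y ⟶ X) hY, inferInstance, id⟩
    · exact ⟨Y, i, hY, hi, fun h => (hX h).elim⟩
  choose T i hT hi hT₀ using h₀
  let j := toMappingConeId K (Z := ofZeroDifferential (fun n => T (K.X n))) (fun _ _ => rfl)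
    (fun n => i (K.X n))
  have : Mono j := mono_toMappingConeId K _ _ (fun n => hi (K.X n))
  let S := ShortComplex.mk j (cokernel.π _)
    (cokernel.condition _)
  have hS : S.ShortExact :=
    { exact := S.exact_of_g_is_cokernel (cokernelIsCokernel _)
      mono_f := this
      epi_g := inferInstanceAs (Epi (cokernel.π _)) }
  obtain ⟨s, hs⟩ := exists_shift_quasiIso hS (isZero_quotient_mappingCone_id _)
  have hg (n : ℤ) : Epi (S.g.f n) := by
    have := hS.epi_g
    infer_instance
  obtain ⟨t, ht⟩ := (HomotopyCategory.subcategoryAcyclic C).exists_trW_of_shift s hs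
  refine ⟨S.X₃⟦(-1 : ℤ)⟧, t ≫ ((HomotopyCategory.quotient C
    (ComplexShape.up ℤ)).commShiftIso (-1 : ℤ)).inv.app S.X₃,
    ((HomotopyCategory.subcategoryAcyclic C).trW.cancel_right_of_respectsIso _ _).2 ht,
    fun n => ?_, fun n h₁ h₂ => ?_⟩
  · exact @hP' _ _ (S.g.f (n + -1)) (hg _) (prop_mappingCone_id P hP (fun n => hT _) _)
  -- After the shift, the term in degree $n$ is a quotient of $T(K^n)\oplus T(K^{n-1})$.
  · have : IsZero (S.X₂.X (n + -1)) := by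
      refine (mappingCone.isZero_X_iff (𝟙 (ofZeroDifferential _)) (n + -1)).2
        ⟨hT₀ _ ?_, hT₀ _ h₁⟩
      rwa [show n + -1 + 1 = n by lia]
    exact @IsZero.of_epi _ _ _ _ _ (S.g.f (n + -1)) (hg _) this

/-- Dual construction: cover `K` by a contractible complex with terms in `P` and shift the kernel by
$1$. -/
theorem exists_left_resolution (hP : ∀ X Y, P X → P Y → P (X ⊞ Y))
    (hP' : ∀ ⦃X Y : C⦄ (f : X ⟶ Y) [Mono f], P Y → P X)
    (h : ∀ X : C, ∃ (Y : C) (p : Y ⟶ X), P Y ∧ Epi p) (K : CochainComplex C ℤ) :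
    ∃ (L : CochainComplex C ℤ) (s : (HomotopyCategory.quotient C (ComplexShape.up ℤ)).obj L ⟶
      (HomotopyCategory.quotient C (ComplexShape.up ℤ)).obj K),
      (HomotopyCategory.subcategoryAcyclic C).trW s ∧ (∀ n, P (L.X n)) ∧
      ∀ n, IsZero (K.X n) → IsZero (K.X (n + 1)) → IsZero (L.X n) := by
  have : P.IsClosedUnderIsomorphisms := ⟨fun e hX => hP' e.inv hX⟩
  have h₀ (X : C) : ∃ (Y : C) (p : Y ⟶ X), P Y ∧ Epi p ∧ (IsZero X → IsZero Y) := by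
    obtain ⟨Y, p, hY, hp⟩ := h X
    by_cases hX : IsZero X
    · have : Mono (0 : X ⟶ Y) := ⟨fun _ _ _ => hX.eq_of_tgt _ _⟩
      exact ⟨X, 𝟙 X, hP' (0 : X ⟶ Y) hY, inferInstance, id⟩
    · exact ⟨Y, p, hY, hp, fun h => (hX h).elim⟩
  choose T p hT hp hT₀ using h₀
  -- The index is lowered by one because $Z^{n+1}$ is the summand of the cone that must cover $K^n$.
  let r := ofMappingConeId K (Z := ofZeroDifferential (fun n => T (K.X (n - 1)))) (fun _ _ => rfl)
    (fun n => p (K.X (n + 1 - 1)) ≫ (K.XIsoOfEq (add_sub_cancel_right n 1)).hom)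
  have hp' (n : ℤ) : Epi (p (K.X (n + 1 - 1)) ≫
      (K.XIsoOfEq (add_sub_cancel_right n 1)).hom) := by
    have := hp (K.X (n + 1 - 1))
    infer_instance
  have : Epi r := epi_ofMappingConeId K _ _ hp'
  let S := ShortComplex.mk (kernel.ι _) r
    (kernel.condition _)
  have hS : S.ShortExact :=
    { exact := S.exact_of_f_is_kernel (kernelIsKernel _)
      mono_f := inferInstanceAs (Mono (kernel.ι _))
      epi_g := this }
  obtain ⟨s, hs⟩ := exists_shift_quasiIso hS (isZero_quotient_mappingCone_id _)
  have hf (n : ℤ) : Mono (S.f.f n) := by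
    have := hS.mono_f
    infer_instance
  refine ⟨S.X₁⟦(1 : ℤ)⟧,
    ((HomotopyCategory.quotient C (ComplexShape.up ℤ)).commShiftIso (1 : ℤ)).hom.app _ ≫ s,
    ?_, fun n => ?_, fun n h₁ h₂ => ?_⟩
  · exact ((HomotopyCategory.subcategoryAcyclic C).trW.cancel_left_of_respectsIso _ _).2 hs
  · exact @hP' _ _ (S.f.f (n + 1)) (hf _) (prop_mappingCone_id P hP (fun n => hT _) _)
  · have : IsZero (S.X₂.X (n + 1)) := by
      refine (mappingCone.isZero_X_iff (𝟙 (ofZeroDifferential _)) (n + 1)).2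
        ⟨hT₀ _ ?_, hT₀ _ ?_⟩
      · rwa [show n + 1 + 1 - 1 = n + 1 by lia]
      · rwa [show n + 1 - 1 = n by lia]
    exact @IsZero.of_mono _ _ _ _ _ (S.f.f (n + 1)) (hf _) this

end

end CochainComplex

/-! ### Resolving and coresolving subcategories; transfer of acyclicity -/

namespace CategoryTheory

section

variable {T C D : Type*} [Category* T] [Category* C] [Category* D] [Preadditive T]
  [HasZeroObject T] [HasBinaryBiproducts T] [Abelian C] [Abelian D]
  (F : T ⥤ C) [F.Additive] [F.Full] [F.Faithful] (G : T ⥤ D) [G.Additive]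

set_option linter.unusedSectionVars false

theorem Functor.exists_iso_mapHomologicalComplex (K : CochainComplex C ℤ)
    (hK : ∀ n, F.essImage (K.X n)) :
    ∃ L : CochainComplex T ℤ,
      Nonempty ((F.mapHomologicalComplex (ComplexShape.up ℤ)).obj L ≅ K) := by
  choose X e using hK
  let e n := (e n).some
  let L : CochainComplex T ℤ :=
    { X := X
      d := fun i j => F.preimage ((e i).hom ≫ K.d i j ≫ (e j).inv)
      shape := fun i j hij => F.map_injective (by simp [K.shape i j hij])
      d_comp_d' := fun i j k _ _ => F.map_injective (by simp) }
  exact ⟨L, ⟨HomologicalComplex.Hom.isoOfComponents e (fun i j _ => by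
    change _ = F.map (F.preimage _) ≫ _
    rw [F.map_preimage]
    exact (by simp : (e i).hom ≫ K.d i j = ((e i).hom ≫ K.d i j ≫ (e j).inv) ≫ (e j).hom))⟩⟩

/-- Precomposing with an epimorphism keeps the image, postcomposing with a monomorphism keeps the
kernel. This splices short exact sequences. -/
theorem ShortComplex.exact_comp_comp {X₀ X₁ X₂ Z₁ Z₂ : C} (p : X₀ ⟶ Z₁) [Epi p] (i : Z₁ ⟶ X₁)
    (q : X₁ ⟶ Z₂) (j : Z₂ ⟶ X₂) [Mono j] {w : i ≫ q = 0} (h : (ShortComplex.mk i q w).Exact)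
    {f : X₀ ⟶ X₁} {g : X₁ ⟶ X₂} (hf : p ≫ i = f) (hg : q ≫ j = g) (w' : f ≫ g = 0) :
    (ShortComplex.mk f g w').Exact := by
  subst hf hg
  let φ : ShortComplex.mk i q w ⟶ ShortComplex.mk i (q ≫ j) (by rw [reassoc_of% w, zero_comp]) :=
    ShortComplex.homMk (𝟙 Z₁) (𝟙 X₁) j (by simp) (by simp)
  have : Epi φ.τ₁ := inferInstanceAs (Epi (𝟙 Z₁))
  have : IsIso φ.τ₂ := inferInstanceAs (IsIso (𝟙 X₁))
  have : Mono φ.τ₃ := inferInstanceAs (Mono j)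
  have h' := (ShortComplex.exact_iff_of_epi_of_isIso_of_mono φ).1 h
  let ψ : ShortComplex.mk (p ≫ i) (q ≫ j) w' ⟶
      ShortComplex.mk i (q ≫ j) (by rw [reassoc_of% w, zero_comp]) :=
    ShortComplex.homMk p (𝟙 X₁) (𝟙 X₂) (by simp) (by simp)
  have : Epi ψ.τ₁ := inferInstanceAs (Epi p)
  have : IsIso ψ.τ₂ := inferInstanceAs (IsIso (𝟙 X₁))
  have : Mono ψ.τ₃ := inferInstanceAs (Mono (𝟙 X₂))
  exact (ShortComplex.exact_iff_of_epi_of_isIso_of_mono ψ).2 h'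

theorem ShortComplex.exact_of_iso_kernel {X₁ X₂ Z₁ Z₂ : C} {d : X₁ ⟶ X₂}
    (e : Z₁ ≅ Limits.kernel d) {i : Z₁ ⟶ X₁} {q : X₁ ⟶ Z₂} {j : Z₂ ⟶ X₂} [Mono j]
    (hi : e.hom ≫ kernel.ι d = i) (hd : q ≫ j = d) (w : i ≫ q = 0) :
    (ShortComplex.mk i q w).Exact := by
  have h : (ShortComplex.mk (kernel.ι d) d (by simp)).Exact :=
    ShortComplex.exact_of_f_is_kernel _ (kernelIsKernel _)
  let φ : ShortComplex.mk i q w ⟶ ShortComplex.mk (kernel.ι d) d (by simp) :=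
    ShortComplex.homMk e.hom (𝟙 X₁) j (by simp [hi]) (by simp [hd])
  have : Epi φ.τ₁ := inferInstanceAs (Epi e.hom)
  have : IsIso φ.τ₂ := inferInstanceAs (IsIso (𝟙 X₁))
  have : Mono φ.τ₃ := inferInstanceAs (Mono j)
  exact (ShortComplex.exact_iff_of_epi_of_isIso_of_mono φ).2 h

theorem Functor.exactAt_mapHomologicalComplex_iff (L : CochainComplex T ℤ) (n : ℤ) :
    ((G.mapHomologicalComplex (ComplexShape.up ℤ)).obj L).ExactAt (n + 1) ↔
      (ShortComplex.mk (G.map (L.d n (n + 1))) (G.map (L.d (n + 1) (n + 1 + 1)))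
        (by simp [← G.map_comp])).Exact :=
  HomologicalComplex.exactAt_iff' _ n (n + 1) (n + 1 + 1) (by simp) (by simp)

/-- If `G` preserves the short exact sequences detected by `F`, and the kernels of the differentials
of a complex acyclic for `F` stay in the image of `F`, then the complex is acyclic for `G`. -/
theorem Functor.exactAt_of_exactAt
    (hFG : ∀ S : ShortComplex T, (S.map F).ShortExact → (S.map G).ShortExact)
    (L : CochainComplex T ℤ)
    (hL : ∀ n, ((F.mapHomologicalComplex (ComplexShape.up ℤ)).obj L).ExactAt n)
    (hZ : ∀ n, F.essImage (Limits.kernel (F.map (L.d n (n + 1))))) (n : ℤ) :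
    ((G.mapHomologicalComplex (ComplexShape.up ℤ)).obj L).ExactAt n := by
  let d (n : ℤ) := F.map (L.d n (n + 1))
  have hd (n : ℤ) : d n ≫ d (n + 1) = 0 := by simp [d, ← F.map_comp]
  let p (n : ℤ) : F.obj (L.X n) ⟶ Limits.kernel (d (n + 1)) := kernel.lift _ (d n) (hd n)
  have hp (n : ℤ) : Epi (p n) := by
    have := (F.exactAt_mapHomologicalComplex_iff L n).1 (hL (n + 1))
    rw [ShortComplex.exact_iff_epi_kernel_lift] at this
    exact this
  choose Z e using hZ
  let e n := (e n).some
  obtain ⟨i, hi⟩ : ∃ i : ∀ n, Z n ⟶ L.X n, ∀ n, F.map (i n) = (e n).hom ≫ kernel.ι (d n) :=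
    ⟨fun n => F.preimage _, fun n => F.map_preimage _⟩
  obtain ⟨q, hq⟩ : ∃ q : ∀ n, L.X n ⟶ Z (n + 1), ∀ n, F.map (q n) = p n ≫ (e (n + 1)).inv :=
    ⟨fun n => F.preimage _, fun n => F.map_preimage _⟩
  have hqi (n : ℤ) : q n ≫ i (n + 1) = L.d n (n + 1) := F.map_injective (by simp [hi, hq, p, d])
  have hiq (n : ℤ) : i n ≫ q n = 0 := F.map_injective (by
    have : kernel.ι (d n) ≫ p n = 0 := by
      rw [← cancel_mono (kernel.ι _)]
      simp [p]
    simp [hi, hq, reassoc_of% this])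
  have hmono (n : ℤ) : Mono (F.map (i n)) := by
    rw [hi]
    infer_instance
  have hepi (n : ℤ) : Epi (F.map (q n)) := by
    rw [hq]
    infer_instance
  have hS (n : ℤ) : ((ShortComplex.mk (i n) (q n) (hiq n)).map F).ShortExact :=
    { exact := ShortComplex.exact_of_iso_kernel (e n) (hi n).symm
        (show F.map (q n) ≫ F.map (i (n + 1)) = d n by rw [← F.map_comp, hqi]) _
      mono_f := hmono n
      epi_g := hepi n }
  obtain ⟨m, rfl⟩ : ∃ m, n = m + 1 := ⟨n - 1, by simp⟩
  rw [exactAt_mapHomologicalComplex_iff]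
  -- Exactness in degree `m + 1` comes from the middle sequence; its neighbours only supply the
  -- epimorphism before it and the monomorphism after it.
  have h₁ := hFG _ (hS m)
  have h₂ := hFG _ (hS (m + 1))
  have h₃ := hFG _ (hS (m + 1 + 1))
  have : Epi (G.map (q m)) := h₁.epi_g
  have : Mono (G.map (i (m + 1 + 1))) := h₃.mono_f
  exact ShortComplex.exact_comp_comp (G.map (q m)) (G.map (i (m + 1))) (G.map (q (m + 1)))
    (G.map (i (m + 1 + 1))) h₂.exact (by rw [← G.map_comp, hqi]) (by rw [← G.map_comp, hqi]) _

theorem Functor.essImage_biprod {X Y : C} (hX : F.essImage X) (hY : F.essImage Y) :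
    F.essImage (X ⊞ Y) := by
  obtain ⟨X', ⟨e⟩⟩ := hX
  obtain ⟨Y', ⟨e'⟩⟩ := hY
  have := preservesBinaryBiproduct_of_preservesBiproduct F X' Y'
  exact ⟨X' ⊞ Y', ⟨F.mapBiprod X' Y' ≪≫ biprod.mapIso e e'⟩⟩

/-- An additive functor `F` to an abelian category whose image is closed under quotients and
cogenerates. -/
structure Functor.IsCoresolving : Prop where
  quotient : ∀ ⦃X Y : C⦄ (f : X ⟶ Y), Epi f → F.essImage X → F.essImage Y
  exists_mono : ∀ X : C, ∃ (Y : T) (i : X ⟶ F.obj Y), Mono i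

/-- An additive functor `F` to an abelian category whose image is closed under subobjects and
generates. -/
structure Functor.IsResolving : Prop where
  subobject : ∀ ⦃X Y : C⦄ (f : X ⟶ Y), Mono f → F.essImage Y → F.essImage X
  exists_epi : ∀ X : C, ∃ (Y : T) (p : F.obj Y ⟶ X), Epi p

variable {F}

/-- The vanishing condition involves three consecutive degrees so that it has the same form for left
resolutions, which look at $n,n+1$ instead of $n-1,n$. -/
theorem Functor.IsCoresolving.exists_resolution (hF : F.IsCoresolving)
    (K : CochainComplex C ℤ) :
    ∃ (L : CochainComplex T ℤ) (s : (HomotopyCategory.quotient C (ComplexShape.up ℤ)).obj K ⟶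
      (F.mapHomotopyCategory (ComplexShape.up ℤ)).obj ((HomotopyCategory.quotient T _).obj L)),
      (HomotopyCategory.subcategoryAcyclic C).trW s ∧
      ∀ n, IsZero (K.X (n - 1)) → IsZero (K.X n) → IsZero (K.X (n + 1)) → IsZero (L.X n) := by
  obtain ⟨M, s, hs, hM, hM₀⟩ := CochainComplex.exists_right_resolution F.essImage
    (fun _ _ => F.essImage_biprod) (fun _ _ f hf => hF.quotient f hf) (fun X => by
      obtain ⟨Y, i, hi⟩ := hF.exists_mono X
      exact ⟨_, i, F.obj_mem_essImage Y, hi⟩) K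
  obtain ⟨L, ⟨e⟩⟩ := F.exists_iso_mapHomologicalComplex M hM
  let e' : (F.mapHomotopyCategory (ComplexShape.up ℤ)).obj
    ((HomotopyCategory.quotient T _).obj L) ≅ _ :=
    (HomotopyCategory.quotient C (ComplexShape.up ℤ)).mapIso e
  refine ⟨L, s ≫ e'.inv,
    ((HomotopyCategory.subcategoryAcyclic C).trW.cancel_right_of_respectsIso _ _).2 hs,
    fun n h₁ h₂ _ => ?_⟩
  have : IsZero (F.obj (L.X n)) :=
    (hM₀ n h₁ h₂).of_iso ((HomologicalComplex.eval C _ n).mapIso e)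
  rw [IsZero.iff_id_eq_zero] at this ⊢
  exact F.map_injective (by simpa using this)

theorem Functor.IsResolving.exists_resolution (hF : F.IsResolving)
    (K : CochainComplex C ℤ) :
    ∃ (L : CochainComplex T ℤ) (s : (F.mapHomotopyCategory (ComplexShape.up ℤ)).obj
      ((HomotopyCategory.quotient T _).obj L) ⟶
        (HomotopyCategory.quotient C (ComplexShape.up ℤ)).obj K),
      (HomotopyCategory.subcategoryAcyclic C).trW s ∧
      ∀ n, IsZero (K.X (n - 1)) → IsZero (K.X n) → IsZero (K.X (n + 1)) → IsZero (L.X n) := by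
  obtain ⟨M, s, hs, hM, hM₀⟩ := CochainComplex.exists_left_resolution F.essImage
    (fun _ _ => F.essImage_biprod) (fun _ _ f hf => hF.subobject f hf) (fun X => by
      obtain ⟨Y, p, hp⟩ := hF.exists_epi X
      exact ⟨_, p, F.obj_mem_essImage Y, hp⟩) K
  obtain ⟨L, ⟨e⟩⟩ := F.exists_iso_mapHomologicalComplex M hM
  let e' : (F.mapHomotopyCategory (ComplexShape.up ℤ)).obj
    ((HomotopyCategory.quotient T _).obj L) ≅ _ :=
    (HomotopyCategory.quotient C (ComplexShape.up ℤ)).mapIso e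
  refine ⟨L, e'.hom ≫ s,
    ((HomotopyCategory.subcategoryAcyclic C).trW.cancel_left_of_respectsIso _ _).2 hs,
    fun n _ h₁ h₂ => ?_⟩
  have : IsZero (F.obj (L.X n)) :=
    (hM₀ n h₁ h₂).of_iso ((HomologicalComplex.eval C _ n).mapIso e)
  rw [IsZero.iff_id_eq_zero] at this ⊢
  exact F.map_injective (by simpa using this)

/-- By acyclicity each kernel of a differential is a quotient of the preceding term, so it stays in
the image of `F`. -/
theorem Functor.IsCoresolving.exactAt_of_exactAt (hF : F.IsCoresolving)
    (hFG : ∀ S : ShortComplex T, (S.map F).ShortExact → (S.map G).ShortExact)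
    (L : CochainComplex T ℤ)
    (hL : ∀ n, ((F.mapHomologicalComplex (ComplexShape.up ℤ)).obj L).ExactAt n) (n : ℤ) :
    ((G.mapHomologicalComplex (ComplexShape.up ℤ)).obj L).ExactAt n := by
  refine F.exactAt_of_exactAt G hFG L hL (fun n => ?_) n
  obtain ⟨m, rfl⟩ : ∃ m, n = m + 1 := ⟨n - 1, by simp⟩
  have := (F.exactAt_mapHomologicalComplex_iff L m).1 (hL (m + 1))
  rw [ShortComplex.exact_iff_epi_kernel_lift] at this
  exact hF.quotient _ this (F.obj_mem_essImage (L.X m))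

theorem Functor.IsResolving.exactAt_of_exactAt (hF : F.IsResolving)
    (hFG : ∀ S : ShortComplex T, (S.map F).ShortExact → (S.map G).ShortExact)
    (L : CochainComplex T ℤ)
    (hL : ∀ n, ((F.mapHomologicalComplex (ComplexShape.up ℤ)).obj L).ExactAt n) (n : ℤ) :
    ((G.mapHomologicalComplex (ComplexShape.up ℤ)).obj L).ExactAt n :=
  F.exactAt_of_exactAt G hFG L hL
    (fun n => hF.subobject (kernel.ι _) inferInstance (F.obj_mem_essImage (L.X n))) n

end

end CategoryTheory

/-! ### Derived categories as localizations of the homotopy category of a subcategory -/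

namespace CategoryTheory

section

variable {T C : Type*} [Category* T] [Category* C] [Preadditive T]
  [Abelian C]
  (F : T ⥤ C) [F.Additive]

/-- The homotopy category objects which become acyclic after the application of `F`. -/
abbrev Functor.acyclic : ObjectProperty (HomotopyCategory T (ComplexShape.up ℤ)) :=
  (HomotopyCategory.subcategoryAcyclic C).inverseImage (F.mapHomotopyCategory (ComplexShape.up ℤ))

theorem Functor.acyclic_iff (L : CochainComplex T ℤ) :
    F.acyclic ((HomotopyCategory.quotient T _).obj L) ↔
      ∀ n, ((F.mapHomologicalComplex (ComplexShape.up ℤ)).obj L).ExactAt n :=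
  HomotopyCategory.quotient_obj_mem_subcategoryAcyclic_iff_exactAt _

variable [HasDerivedCategory C]

/-- The functor from the homotopy category of complexes in `T` to the derived category of `C`
which is induced by an additive functor `T ⥤ C`. -/
noncomputable abbrev Functor.toDerivedCategory :
    HomotopyCategory T (ComplexShape.up ℤ) ⥤ DerivedCategory C :=
  F.mapHomotopyCategory (ComplexShape.up ℤ) ⋙ DerivedCategory.Qh

/-- `Functor.toDerivedCategory` on objects. -/
noncomputable def Functor.toDerivedCategoryObjIso (L : CochainComplex T ℤ) :
    F.toDerivedCategory.obj ((HomotopyCategory.quotient T _).obj L) ≅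
      DerivedCategory.Q.obj ((F.mapHomologicalComplex (ComplexShape.up ℤ)).obj L) :=
  (DerivedCategory.quotientCompQhIso C).app _

/-- Every complex is isomorphic in the derived category to the image of a complex in `T`
satisfying the same bounds, up to one degree. -/
def Functor.HasResolutions : Prop :=
  ∀ K : CochainComplex C ℤ, ∃ L : CochainComplex T ℤ,
    Nonempty (F.toDerivedCategory.obj ((HomotopyCategory.quotient T _).obj L) ≅
      DerivedCategory.Q.obj K) ∧
    ∀ n, IsZero (K.X (n - 1)) → IsZero (K.X n) → IsZero (K.X (n + 1)) → IsZero (L.X n)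

variable {F}

/-- Boundedness is expressed through complexes in `T` alone, which allows a comparison between
different ambient abelian categories. -/
theorem Functor.HasResolutions.plus_iff (hF : F.HasResolutions) (X : DerivedCategory C) :
    DerivedCategory.TStructure.t.plus X ↔ ∃ (n : ℤ) (L : CochainComplex T ℤ),
      (∀ i < n, IsZero (L.X i)) ∧
      Nonempty (F.toDerivedCategory.obj ((HomotopyCategory.quotient T _).obj L) ≅ X) := by
  constructor
  · rintro ⟨n, hn⟩
    have hn : X.IsGE n := hn
    obtain ⟨K, hK, ⟨e⟩⟩ := X.exists_iso_Q_obj_of_isGE n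
    obtain ⟨L, ⟨e'⟩, hL⟩ := hF K
    rw [CochainComplex.isStrictlyGE_iff] at hK
    -- Vanishing of $L^i$ uses that of $K^{i+1}$, so $i+1<n$ is needed.
    exact ⟨n - 1, L, fun i hi => hL i (hK _ (by lia)) (hK _ (by lia)) (hK _ (by lia)),
      ⟨e' ≪≫ e.symm⟩⟩
  · rintro ⟨n, L, hL, ⟨e⟩⟩
    have : CochainComplex.IsStrictlyGE
        ((F.mapHomologicalComplex (ComplexShape.up ℤ)).obj L) n :=
      (CochainComplex.isStrictlyGE_iff _ _).2 (fun i hi => F.map_isZero (hL i hi))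
    have : (DerivedCategory.Q.obj
        ((F.mapHomologicalComplex (ComplexShape.up ℤ)).obj L)).IsGE n :=
      (DerivedCategory.isGE_Q_obj_iff _ _).2 inferInstance
    exact ⟨n, DerivedCategory.TStructure.t.isGE_of_iso
      ((F.toDerivedCategoryObjIso L).symm ≪≫ e) n⟩

theorem Functor.HasResolutions.minus_iff (hF : F.HasResolutions) (X : DerivedCategory C) :
    DerivedCategory.TStructure.t.minus X ↔ ∃ (n : ℤ) (L : CochainComplex T ℤ),
      (∀ i > n, IsZero (L.X i)) ∧
      Nonempty (F.toDerivedCategory.obj ((HomotopyCategory.quotient T _).obj L) ≅ X) := by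
  constructor
  · rintro ⟨n, hn⟩
    have hn : X.IsLE n := hn
    obtain ⟨K, hK, ⟨e⟩⟩ := X.exists_iso_Q_obj_of_isLE n
    obtain ⟨L, ⟨e'⟩, hL⟩ := hF K
    rw [CochainComplex.isStrictlyLE_iff] at hK
    exact ⟨n + 1, L, fun i hi => hL i (hK _ (by lia)) (hK _ (by lia)) (hK _ (by lia)),
      ⟨e' ≪≫ e.symm⟩⟩
  · rintro ⟨n, L, hL, ⟨e⟩⟩
    have : CochainComplex.IsStrictlyLE
        ((F.mapHomologicalComplex (ComplexShape.up ℤ)).obj L) n :=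
      (CochainComplex.isStrictlyLE_iff _ _).2 (fun i hi => F.map_isZero (hL i hi))
    have : (DerivedCategory.Q.obj
        ((F.mapHomologicalComplex (ComplexShape.up ℤ)).obj L)).IsLE n :=
      (DerivedCategory.isLE_Q_obj_iff _ _).2 inferInstance
    exact ⟨n, DerivedCategory.TStructure.t.isLE_of_iso
      ((F.toDerivedCategoryObjIso L).symm ≪≫ e) n⟩

theorem Functor.isIso_Qh_map_of_trW {X Y : HomotopyCategory C (ComplexShape.up ℤ)} (s : X ⟶ Y)
    (hs : (HomotopyCategory.subcategoryAcyclic C).trW s) : IsIso (DerivedCategory.Qh.map s) := by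
  rw [← HomotopyCategory.quasiIso_eq_trW_subcategoryAcyclic] at hs
  exact Localization.inverts _ _ _ hs

theorem isLocalization_Qh_trW :
    (DerivedCategory.Qh (C := C)).IsLocalization (HomotopyCategory.subcategoryAcyclic C).trW := by
  rw [← HomotopyCategory.quasiIso_eq_trW_subcategoryAcyclic]
  infer_instance

variable [HasZeroObject T] [HasBinaryBiproducts T] [F.Full] [F.Faithful]

theorem Functor.IsCoresolving.hasResolutions (hF : F.IsCoresolving) : F.HasResolutions := by
  intro K
  obtain ⟨L, s, hs, hL⟩ := hF.exists_resolution K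
  have := isIso_Qh_map_of_trW s hs
  exact ⟨L, ⟨(asIso (DerivedCategory.Qh.map s)).symm ≪≫
    (DerivedCategory.quotientCompQhIso C).app K⟩, hL⟩

theorem Functor.IsResolving.hasResolutions (hF : F.IsResolving) : F.HasResolutions := by
  intro K
  obtain ⟨L, s, hs, hL⟩ := hF.exists_resolution K
  have := isIso_Qh_map_of_trW s hs
  exact ⟨L, ⟨asIso (DerivedCategory.Qh.map s) ≪≫
    (DerivedCategory.quotientCompQhIso C).app K⟩, hL⟩

theorem Functor.IsCoresolving.isLocalization (hF : F.IsCoresolving) :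
    F.toDerivedCategory.IsLocalization F.acyclic.trW := by
  have := isLocalization_Qh_trW (C := C)
  refine isLocalization_comp_of_right_resolutions _ _ _ (fun X => ?_)
  obtain ⟨K, rfl⟩ := HomotopyCategory.quotient_obj_surjective X
  obtain ⟨L, s, hs, _⟩ := hF.exists_resolution K
  exact ⟨_, s, hs⟩

theorem Functor.IsResolving.isLocalization (hF : F.IsResolving) :
    F.toDerivedCategory.IsLocalization F.acyclic.trW := by
  have := isLocalization_Qh_trW (C := C)
  refine isLocalization_comp_of_left_resolutions _ _ _ (fun X => ?_)
  obtain ⟨K, rfl⟩ := HomotopyCategory.quotient_obj_surjective X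
  obtain ⟨L, s, hs, _⟩ := hF.exists_resolution K
  exact ⟨_, s, hs⟩

end

section

variable {T C D : Type*} [Category* T] [Category* C] [Category* D] [Preadditive T]
  [HasZeroObject T] [HasBinaryBiproducts T] [Abelian C] [Abelian D]
  {F : T ⥤ C} [F.Additive] [F.Full] [F.Faithful] {G : T ⥤ D} [G.Additive] [G.Full] [G.Faithful]

/-- Kernels of an acyclic complex stay in `T` on both sides, as quotients for `F` and as subobjects
for `G`; acyclicity thus depends only on the short exact sequences in `T`. -/
theorem Functor.acyclic_eq_acyclic (hF : F.IsCoresolving) (hG : G.IsResolving)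
    (h : ∀ S : ShortComplex T, (S.map F).ShortExact ↔ (S.map G).ShortExact) :
    F.acyclic = G.acyclic := by
  ext X
  obtain ⟨L, rfl⟩ := HomotopyCategory.quotient_obj_surjective X
  rw [F.acyclic_iff, G.acyclic_iff]
  exact ⟨fun hL => hF.exactAt_of_exactAt G (fun S => (h S).1) L hL,
    fun hL => hG.exactAt_of_exactAt F (fun S => (h S).2) L hL⟩

end

section

variable {K D₁ D₂ : Type*} [Category* K] [Category* D₁] [Category* D₂]
  [HasZeroObject K] [HasShift K ℤ] [Preadditive K] [∀ (n : ℤ), (shiftFunctor K n).Additive]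
  [Pretriangulated K]
  [HasZeroObject D₁] [HasShift D₁ ℤ] [Preadditive D₁] [∀ (n : ℤ), (shiftFunctor D₁ n).Additive]
  [Pretriangulated D₁]
  [HasZeroObject D₂] [HasShift D₂ ℤ] [Preadditive D₂] [∀ (n : ℤ), (shiftFunctor D₂ n).Additive]
  [Pretriangulated D₂]

/-- Two triangulated localization functors for the same class of morphisms have triangle
equivalent targets. -/
theorem exists_triangulated_equivalence_of_isLocalization [CategoryTheory.IsTriangulated K]
    (L₁ : K ⥤ D₁) (L₂ : K ⥤ D₂)
    [L₁.CommShift ℤ] [L₁.IsTriangulated] [L₂.CommShift ℤ] [L₂.IsTriangulated]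
    (B : ObjectProperty K) [B.IsTriangulated]
    [L₁.IsLocalization B.trW] [L₂.IsLocalization B.trW] :
    ∃ (Φ : D₁ ⥤ D₂) (_ : Φ.CommShift ℤ), Φ.IsEquivalence ∧ Φ.IsTriangulated ∧
      Nonempty (L₁ ⋙ Φ ≅ L₂) := by
  let Φ := (Localization.uniq L₁ L₂ B.trW).functor
  let e : L₁ ⋙ Φ ≅ L₂ := Localization.Lifting.iso L₁ B.trW L₂ Φ
  let : Φ.CommShift ℤ := Functor.commShiftOfLocalization L₁ B.trW ℤ L₂ Φ
  have he : NatTrans.CommShift e.hom ℤ :=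
    NatTrans.commShift_iso_hom_of_localization L₁ B.trW ℤ L₂ Φ
  -- Every morphism of `D₁` comes from `K` up to isomorphism, so triangulatedness of `Φ` can be
  -- checked after composing with `L₁`.
  have := Localization.essSurj_mapArrow L₁ B.trW
  exact ⟨Φ, inferInstance, inferInstance, Functor.isTriangulated_of_precomp_iso e, ⟨e⟩⟩

end

end CategoryTheory

/-! ### Short exact sequences in a heart and distinguished triangles -/

section

variable {C : Type*} [Category* C] [Preadditive C] [HasZeroObject C] [HasShift C ℤ]
  [∀ (n : ℤ), (shiftFunctor C n).Additive] [Pretriangulated C] (t : TStructure C)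
  (P : ObjectProperty C) (hP : P = t.heart)

include hP

theorem heart_hom_shift_eq_zero ⦃X Y : P.FullSubcategory⦄ ⦃n : ℤ⦄
    (f : P.ι.obj X ⟶ (P.ι.obj Y)⟦n⟧) (hn : n < 0) : f = 0 := by
  subst hP
  have := ((t.mem_heart_iff _).1 X.2).1
  have := ((t.mem_heart_iff _).1 Y.2).2
  have : t.IsGE ((t.heart.ι.obj Y)⟦n⟧) (-n) := t.isGE_shift Y.1 0 n (-n) (by lia)
  have : t.IsLE (t.heart.ι.obj X) 0 := ‹t.IsLE X.1 0›
  exact t.zero f 0 (-n) (by lia)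

/-- The cone of a map in the heart lives in degrees $-1$ and $0$; its truncation triangle has the
shifted kernel and the cokernel as outer terms. -/
theorem heart_admissibleMorphism : AbelianSubcategory.admissibleMorphism P.ι = ⊤ := by
  have hP' (X : C) : P X ↔ t.IsLE X 0 ∧ t.IsGE X 0 := by rw [hP, t.mem_heart_iff]
  ext X₁ X₂ f₁
  simp only [MorphismProperty.top_apply, iff_true]
  intro X₃ f₂ f₃ hT
  have h₁ := (hP' _).1 X₁.2
  have h₂ := (hP' _).1 X₂.2
  have hle : t.IsLE X₃ 0 :=
    t.isLE₂ _ (rot_of_distTriang _ hT) 0 h₂.1 (by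
      have : t.IsLE (P.ι.obj X₁) 0 := h₁.1
      have : t.IsLE ((P.ι.obj X₁)⟦(1 : ℤ)⟧) (-1) := t.isLE_shift _ 0 1 (-1) (by lia)
      exact t.isLE_of_le ((P.ι.obj X₁)⟦(1 : ℤ)⟧) (-1) 0)
  have hge : t.IsGE X₃ (-1) :=
    t.isGE₂ _ (rot_of_distTriang _ hT) (-1) (by
      have : t.IsGE (P.ι.obj X₂) 0 := h₂.2
      exact t.isGE_of_ge (P.ι.obj X₂) (-1) 0) (by
      have : t.IsGE (P.ι.obj X₁) 0 := h₁.2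
      exact t.isGE_shift (P.ι.obj X₁) 0 1 (-1) (by lia))
  obtain ⟨A, B, hA, hB, α, β, γ, hT'⟩ := t.exists_triangle X₃ (-1) 0 (by lia)
  have hA₁ : t.IsLE A (-1) := ⟨hA⟩
  have hB₁ : t.IsGE B 0 := ⟨hB⟩
  have hA₂ : t.IsGE A (-1) :=
    t.isGE₂ _ (inv_rot_of_distTriang _ hT') (-1) (by
      have : t.IsGE (B⟦(-1 : ℤ)⟧) 1 := t.isGE_shift _ 0 (-1) 1 (by lia)
      exact t.isGE_of_ge (B⟦(-1 : ℤ)⟧) (-1) 1) hge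
  have hB₂ : t.IsLE B 0 :=
    t.isLE₂ _ (rot_of_distTriang _ hT') 0 hle (by
      have : t.IsLE (A⟦(1 : ℤ)⟧) (-2) := t.isLE_shift _ (-1) 1 (-2) (by lia)
      exact t.isLE_of_le (A⟦(1 : ℤ)⟧) (-2) 0)
  let e : (A⟦(-1 : ℤ)⟧)⟦(1 : ℤ)⟧ ≅ A := (shiftEquiv C (1 : ℤ)).counitIso.app A
  refine ⟨⟨A⟦(-1 : ℤ)⟧, (hP' _).2
    ⟨t.isLE_shift _ (-1) (-1) 0 (by lia), t.isGE_shift _ (-1) (-1) 0 (by lia)⟩⟩,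
    ⟨B, (hP' _).2 ⟨hB₂, hB₁⟩⟩, e.hom ≫ α, β, γ ≫ e.inv⟦(1 : ℤ)⟧', ?_⟩
  refine isomorphic_distinguished _ hT' _
    (Triangle.isoMk _ _ e (Iso.refl _) (Iso.refl _) (Category.comp_id _)
      ((Category.comp_id _).trans (Category.id_comp _).symm) ?_)
  have he : e.inv⟦(1 : ℤ)⟧' ≫ e.hom⟦(1 : ℤ)⟧' = 𝟙 (A⟦(1 : ℤ)⟧) := by
    rw [← Functor.map_comp, e.inv_hom_id, CategoryTheory.Functor.map_id]
  refine (Category.assoc _ _ _).trans (Eq.trans ?_ (Category.id_comp _).symm)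
  exact (congrArg (γ ≫ ·) he).trans (Category.comp_id γ)

end

namespace TorsionPair

variable {A : Type u} [Category.{v} A] [Abelian A] (τ : TorsionPair A) [HasDerivedCategory.{w} A]

/-- Since negative Homs between heart objects vanish, the two maps of such a triangle are kernel and
cokernel of each other. -/
theorem shortExact_of_distTriang (S : ShortComplex τ.Heart)
    (δ : τ.heart.ι.obj S.X₃ ⟶ (τ.heart.ι.obj S.X₁)⟦(1 : ℤ)⟧)
    (hδ : Triangle.mk (τ.heart.ι.map S.f) (τ.heart.ι.map S.g) δ ∈ distTriang _) :
    S.ShortExact := by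
  have hι := heart_hom_shift_eq_zero _ _ τ.heart_eq
  have hk := AbelianSubcategory.isLimitKernelForkOfDistTriang hι S.f S.g δ hδ
  have hc := AbelianSubcategory.isColimitCokernelCoforkOfDistTriang hι S.f S.g δ hδ
  exact
    { exact := ShortComplex.exact_of_f_is_kernel _ hk
      mono_f := mono_of_isLimit_fork hk
      epi_g := epi_of_isColimit_cofork hc }

/-- An epimorphism of the heart completes to a triangle whose first term is in the heart; that term
is a kernel, hence isomorphic to `S.X₁`. -/
theorem exists_distTriang_of_shortExact (S : ShortComplex τ.Heart) (hS : S.ShortExact) :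
    ∃ δ : τ.heart.ι.obj S.X₃ ⟶ (τ.heart.ι.obj S.X₁)⟦(1 : ℤ)⟧,
      Triangle.mk (τ.heart.ι.map S.f) (τ.heart.ι.map S.g) δ ∈ distTriang _ := by
  have hι := heart_hom_shift_eq_zero _ _ τ.heart_eq
  have := hS.epi_g
  obtain ⟨K, i, δ, hδ⟩ := AbelianSubcategory.exists_distinguished_triangle_of_epi hι
    (heart_admissibleMorphism _ _ τ.heart_eq) S.g
  have hk := AbelianSubcategory.isLimitKernelForkOfDistTriang hι i S.g δ hδ
  let e : S.X₁ ≅ K := IsLimit.conePointUniqueUpToIso hS.fIsKernel hk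
  have he : e.hom ≫ i = S.f := IsLimit.conePointUniqueUpToIso_hom_comp hS.fIsKernel hk .zero
  refine ⟨δ ≫ (τ.heart.ι.map e.inv)⟦1⟧', isomorphic_distinguished _ hδ _
    (Triangle.isoMk _ _ (τ.heart.ι.mapIso e) (Iso.refl _) (Iso.refl _) ?_ ?_ ?_)⟩
  · exact (Category.comp_id _).trans (by rw [← he, Functor.map_comp]; rfl)
  · exact (Category.comp_id _).trans (Category.id_comp _).symm
  · have h : (τ.heart.ι.map e.inv)⟦(1 : ℤ)⟧' ≫ (τ.heart.ι.map e.hom)⟦(1 : ℤ)⟧' = 𝟙 _ := by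
      rw [← Functor.map_comp, ← Functor.map_comp, e.inv_hom_id,
        CategoryTheory.Functor.map_id, CategoryTheory.Functor.map_id]
    exact (Category.assoc _ _ _).trans ((congrArg (δ ≫ ·) h).trans
      ((Category.comp_id _).trans (Category.id_comp _).symm))

end TorsionPair

/-! ### Comparing functors that agree on a resolving subcategory -/

namespace CategoryTheory

section

variable {T B D : Type*} [Category* T] [Category* B] [Category* D] [Abelian B]
  [HasZeroObject D] [HasShift D ℤ] [Preadditive D] [∀ (n : ℤ), (shiftFunctor D n).Additive]
  [Pretriangulated D]

/-- A functor from an abelian category to a pretriangulated category which sends short exact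
sequences to distinguished triangles. -/
def Functor.MapsShortExactToDistTriang (G : B ⥤ D) : Prop :=
  ∀ S : ShortComplex B, S.ShortExact → ∃ δ : G.obj S.X₃ ⟶ (G.obj S.X₁)⟦(1 : ℤ)⟧,
    Triangle.mk (G.map S.f) (G.map S.g) δ ∈ distTriang D

variable {F : T ⥤ B} (hF : F.IsResolving)

include hF

theorem Functor.IsResolving.exists_shortExact [F.Full] {X : T} {M : B} (p : F.obj X ⟶ M) [Epi p] :
    ∃ (Y : T) (f : Y ⟶ X) (w : F.map f ≫ p = 0), (ShortComplex.mk (F.map f) p w).ShortExact := by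
  obtain ⟨Y, ⟨e⟩⟩ := hF.subobject (kernel.ι p) inferInstance (F.obj_mem_essImage X)
  obtain ⟨f, hf⟩ := F.map_surjective (e.hom ≫ kernel.ι p)
  have w : F.map f ≫ p = 0 := by simp [hf]
  have : Mono (F.map f) := by
    rw [hf]
    infer_instance
  refine ⟨Y, f, w, { exact := ?_, mono_f := this, epi_g := ‹_› }⟩
  exact ShortComplex.exact_of_iso_kernel e hf.symm (Category.comp_id p) w

variable [F.Full] {G₁ G₂ : B ⥤ D} (h₁ : G₁.MapsShortExactToDistTriang)
  (h₂ : G₂.MapsShortExactToDistTriang)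
  (h : ∀ ⦃X Y : B⦄ (f : (G₂.obj X)⟦(1 : ℤ)⟧ ⟶ G₂.obj Y), f = 0) (α : F ⋙ G₁ ≅ F ⋙ G₂)

include h₁ h α in
-- The difference `f - g` factors through $G_1(FY)[1]\cong G_2(FY)[1]$, where $FY$ is the kernel of
-- `p`, and no nonzero map leads from there to $G_2N$.
theorem Functor.IsResolving.map_comp_injective {X : T} {M N : B} (p : F.obj X ⟶ M) [Epi p]
    {f g : G₁.obj M ⟶ G₂.obj N} (hfg : G₁.map p ≫ f = G₁.map p ≫ g) : f = g := by
  obtain ⟨Y, i, w, hS⟩ := hF.exists_shortExact p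
  obtain ⟨δ, hδ⟩ := h₁ _ hS
  obtain ⟨k, hk⟩ : ∃ k : (G₁.obj (F.obj Y))⟦(1 : ℤ)⟧ ⟶ G₂.obj N, f - g = δ ≫ k :=
    Triangle.yoneda_exact₃ _ hδ (f - g) ((Preadditive.comp_sub _ _ _).trans (sub_eq_zero.2 hfg))
  have hk₀ : k = 0 := by
    have : (α.inv.app Y)⟦(1 : ℤ)⟧' ≫ k = 0 := h _
    exact (cancel_epi ((α.inv.app Y)⟦(1 : ℤ)⟧')).1 (this.trans comp_zero.symm)
  rw [← sub_eq_zero, hk, hk₀, comp_zero]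

include h₁ h₂ in
-- `α` on the first two terms of a presentation extends to the cones. The extension is not canonical
-- in general; here `map_comp_injective` makes it unique.
theorem Functor.IsResolving.exists_iso_obj {X : T} {M : B} (p : F.obj X ⟶ M) [Epi p] :
    ∃ e : G₁.obj M ≅ G₂.obj M, G₁.map p ≫ e.hom = α.hom.app X ≫ G₂.map p := by
  obtain ⟨Y, i, w, hS⟩ := hF.exists_shortExact p
  obtain ⟨δ₁, hδ₁⟩ := h₁ _ hS
  obtain ⟨δ₂, hδ₂⟩ := h₂ _ hS
  obtain ⟨e, he, he'⟩ := complete_distinguished_triangle_morphism _ _ hδ₁ hδ₂ (α.hom.app Y)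
    (α.hom.app X) (α.hom.naturality i)
  let φ : Triangle.mk (G₁.map (F.map i)) (G₁.map p) δ₁ ⟶
      Triangle.mk (G₂.map (F.map i)) (G₂.map p) δ₂ :=
    Triangle.homMk _ _ (α.hom.app Y) (α.hom.app X) e (α.hom.naturality i) he he'
  have hφ : IsIso φ.hom₃ := isIso₃_of_isIso₁₂ φ hδ₁ hδ₂ (inferInstanceAs (IsIso (α.hom.app Y)))
    (inferInstanceAs (IsIso (α.hom.app X)))
  exact ⟨@asIso _ _ _ _ e hφ, he⟩

include h₁ h in
-- Independence of the presentation: an object of `T` covering the pullback of `q` and `p` reduces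
-- the equation for `q` to the one for `p`, by naturality of `α`.
theorem Functor.IsResolving.map_comp_eq {X Y : T} {M : B} (p : F.obj X ⟶ M) [Epi p]
    {f : G₁.obj M ⟶ G₂.obj M} (hf : G₁.map p ≫ f = α.hom.app X ≫ G₂.map p) (q : F.obj Y ⟶ M) :
    G₁.map q ≫ f = α.hom.app Y ≫ G₂.map q := by
  obtain ⟨Z, r, hr⟩ := hF.exists_epi (pullback q p)
  obtain ⟨a, ha⟩ := F.map_surjective (r ≫ pullback.fst q p)
  obtain ⟨b, hb⟩ := F.map_surjective (r ≫ pullback.snd q p)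
  have : Epi (F.map a) := by
    rw [ha]
    infer_instance
  have hab : F.map a ≫ q = F.map b ≫ p := by simp [ha, hb, pullback.condition]
  have hαa : G₁.map (F.map a) ≫ α.hom.app Y = α.hom.app Z ≫ G₂.map (F.map a) :=
    α.hom.naturality a
  have hαb : G₁.map (F.map b) ≫ α.hom.app X = α.hom.app Z ≫ G₂.map (F.map b) :=
    α.hom.naturality b
  apply hF.map_comp_injective h₁ h α (F.map a)
  rw [← Category.assoc, ← Functor.map_comp, hab, Functor.map_comp, Category.assoc, hf,
    ← Category.assoc, hαb, Category.assoc, ← Functor.map_comp, ← hab, Functor.map_comp,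
    ← Category.assoc, ← Category.assoc, hαa]

include h₁ h₂ h α in
/-- Two functors sending short exact sequences to distinguished triangles are isomorphic if they
agree on a resolving subcategory and there are no nonzero extensions of negative degree. -/
theorem Functor.IsResolving.nonempty_iso : Nonempty (G₁ ≅ G₂) := by
  choose X p hp using hF.exists_epi
  choose e he using fun M => hF.exists_iso_obj h₁ h₂ α (p M)
  refine ⟨NatIso.ofComponents e (fun {M N} f => ?_)⟩
  apply hF.map_comp_injective h₁ h α (p M)
  -- Naturality at `f` is compatibility of `e N` with the map `p M ≫ f`, which need not be epi.
  rw [← Category.assoc, ← Functor.map_comp,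
    hF.map_comp_eq h₁ h α (p N) (he N) (p M ≫ f), Functor.map_comp, ← Category.assoc, ← he,
    Category.assoc]

end

end CategoryTheory

/-! ### Torsion objects inside $\mathcal A$ and inside the tilted heart -/

namespace TorsionPair

variable {A : Type u} [Category.{v} A] [Abelian A] (τ : TorsionPair A)

theorem T_of_epi {X Y : A} (f : X ⟶ Y) [Epi f] (hX : τ.T X) : τ.T Y :=
  τ.T_of_hom_eq_zero (fun _ hZ g => by
    rw [← cancel_epi f, comp_zero]
    exact τ.hom_eq_zero hX hZ _)

theorem T_of_exact {S : ShortComplex A} (hS : S.Exact) [Epi S.g] (h₁ : τ.T S.X₁)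
    (h₃ : τ.T S.X₃) : τ.T S.X₂ :=
  τ.T_of_hom_eq_zero (fun _ hZ g => by
    rw [← hS.g_desc g (τ.hom_eq_zero h₁ hZ _), τ.hom_eq_zero h₃ hZ (hS.desc g _), comp_zero])

instance : τ.T.IsClosedUnderIsomorphisms := ⟨fun e hX => τ.T_of_iso e hX⟩

instance : τ.T.IsClosedUnderFiniteProducts := by
  have : τ.T.IsClosedUnderBinaryProducts :=
    { limitsOfShape_le := by
        rintro X ⟨p⟩
        refine τ.T_of_hom_eq_zero (fun Y hY f => ?_)
        let e : p.diag.obj (.mk .left) ⊞ p.diag.obj (.mk .right) ≅ X :=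
          biprod.isoProd _ _ ≪≫ IsLimit.conePointUniqueUpToIso (prodIsProd _ _)
            ((IsLimit.postcomposeHomEquiv (diagramIsoPair p.diag) _).2 p.isLimit)
        rw [← cancel_epi e.hom, comp_zero]
        exact biprod.hom_ext' _ _ ((τ.hom_eq_zero (p.prop_diag_obj _) hY _).trans comp_zero.symm)
          ((τ.hom_eq_zero (p.prop_diag_obj _) hY _).trans comp_zero.symm) }
  have : τ.T.ContainsZero := ⟨⟨_, isZero_zero A, τ.T_of_isZero (isZero_zero A)⟩⟩
  exact .mk'

instance : HasZeroObject τ.T.FullSubcategory := hasZeroObject_of_hasTerminal_object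

instance : HasBinaryBiproducts τ.T.FullSubcategory := HasBinaryBiproducts.of_hasBinaryProducts

variable {τ} in
theorem IsTilting.isCoresolving (hτ : τ.IsTilting) : τ.T.ι.IsCoresolving where
  quotient X Y f hf := by
    rintro ⟨X', ⟨e⟩⟩
    exact ⟨⟨Y, τ.T_of_epi f (τ.T_of_iso e X'.2)⟩, ⟨Iso.refl _⟩⟩
  exists_mono X := by
    obtain ⟨Y, i, hY, hi⟩ := hτ X
    exact ⟨⟨Y, hY⟩, i, hi⟩

variable [HasDerivedCategory.{w} A]

theorem heart_singleFunctor_obj {X : A} (hX : τ.T X) :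
    τ.heart ((DerivedCategory.singleFunctor A 0).obj X) :=
  ⟨τ.T_of_iso ((DerivedCategory.singleFunctorCompHomologyFunctorIso A 0).app X).symm hX,
    τ.F_of_isZero (DerivedCategory.isZero_of_isGE _ 0 (-1) (by lia)), fun i h₀ h₁ => by
      obtain hi | hi : 0 < i ∨ i < 0 := by lia
      · exact DerivedCategory.isZero_of_isLE _ 0 i hi
      · exact DerivedCategory.isZero_of_isGE _ 0 i hi⟩

/-- The inclusion of the torsion objects of `A` in the tilted category. -/
noncomputable def toHeart : τ.T.FullSubcategory ⥤ τ.Heart :=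
  τ.heart.lift (τ.T.ι ⋙ DerivedCategory.singleFunctor A 0) (fun X => τ.heart_singleFunctor_obj X.2)

/-- `toHeart` as a functor to the derived category. -/
noncomputable def toHeartCompιIso :
    τ.toHeart ⋙ τ.heart.ι ≅ τ.T.ι ⋙ DerivedCategory.singleFunctor A 0 := Iso.refl _

instance : τ.toHeart.Full :=
  inferInstanceAs (τ.heart.lift (τ.T.ι ⋙ DerivedCategory.singleFunctor A 0) _).Full

instance : τ.toHeart.Faithful :=
  inferInstanceAs (τ.heart.lift (τ.T.ι ⋙ DerivedCategory.singleFunctor A 0) _).Faithful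

instance : τ.toHeart.Additive where
  map_add := τ.heart.ι.map_injective
    ((τ.T.ι ⋙ DerivedCategory.singleFunctor A 0).map_add)

theorem toHeart_essImage_iff (M : τ.Heart) : τ.toHeart.essImage M ↔
    IsZero ((DerivedCategory.homologyFunctor A (-1)).obj M.1) := by
  constructor
  · rintro ⟨X, ⟨e⟩⟩
    exact (((DerivedCategory.singleFunctor A 0).obj X.1).isZero_of_isGE 0 (-1) (by lia)).of_iso
      ((τ.heart.ι ⋙ DerivedCategory.homologyFunctor A (-1)).mapIso e.symm)
  · intro h
    have hGE : M.1.IsGE 0 := (DerivedCategory.isGE_iff _ _).2 (fun i hi => by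
      by_cases hi' : i = -1
      · exact hi' ▸ h
      · exact M.2.2.2 i (by lia) hi')
    have hLE : M.1.IsLE 0 := (DerivedCategory.isLE_iff _ _).2 (fun i hi =>
      M.2.2.2 i (by lia) (by lia))
    obtain ⟨X, ⟨e⟩⟩ := DerivedCategory.exists_iso_singleFunctor_obj_of_isGE_of_isLE M.1 0
    exact ⟨⟨X, τ.T_of_iso ((DerivedCategory.homologyFunctor A 0).mapIso e ≪≫
      (DerivedCategory.singleFunctorCompHomologyFunctorIso A 0).app X) M.2.1⟩,
      ⟨τ.heart.ι.preimageIso e.symm⟩⟩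

/-- $H^{-2}$ of the cokernel vanishes, so $H^{-1}(M)$ embeds into $H^{-1}(N)=0$. -/
theorem toHeart_essImage_of_mono {M N : τ.Heart} (f : M ⟶ N) [Mono f]
    (hN : τ.toHeart.essImage N) : τ.toHeart.essImage M := by
  rw [toHeart_essImage_iff] at hN ⊢
  obtain ⟨δ, hδ⟩ := τ.exists_distTriang_of_shortExact
    (ShortComplex.mk f (cokernel.π f) (cokernel.condition f))
    { exact := ShortComplex.exact_of_g_is_cokernel _ (cokernelIsCokernel f)
      mono_f := ‹_›
      epi_g := inferInstanceAs (Epi (cokernel.π f)) }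
  have h₁ := (DerivedCategory.HomologySequence.mono_homologyMap_mor₁_iff _ hδ (-2) (-1)
    (by lia)).2 (((cokernel f).2.2.2 (-2) (by lia) (by lia)).eq_of_src _ _)
  exact @IsZero.of_mono _ _ _ _ _ _ h₁ hN

/-- Both sides amount to a distinguished triangle of stalk complexes in $D(\mathcal A)$; exactness
in $\mathcal A$ is recovered from $H^0$, the neighbouring cohomology being zero. -/
theorem shortExact_map_toHeart_iff (S : ShortComplex τ.T.FullSubcategory) :
    (S.map τ.T.ι).ShortExact ↔ (S.map τ.toHeart).ShortExact := by
  constructor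
  · intro hS
    exact τ.shortExact_of_distTriang _ _ hS.singleTriangle_distinguished
  · intro hS
    obtain ⟨δ, hδ⟩ := τ.exists_distTriang_of_shortExact _ hS
    have hGE (X : A) : IsZero ((DerivedCategory.homologyFunctor A (-1)).obj
        ((DerivedCategory.singleFunctor A 0).obj X)) :=
      DerivedCategory.isZero_of_isGE _ 0 (-1) (by lia)
    have hLE (X : A) : IsZero ((DerivedCategory.homologyFunctor A 1).obj
        ((DerivedCategory.singleFunctor A 0).obj X)) :=
      DerivedCategory.isZero_of_isLE _ 0 1 (by lia)
    let S' := (S.map τ.T.ι).map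
      (DerivedCategory.singleFunctor A 0 ⋙ DerivedCategory.homologyFunctor A 0)
    have h : S'.ShortExact :=
      { exact := DerivedCategory.HomologySequence.exact₂ _ hδ 0
        mono_f := (DerivedCategory.HomologySequence.mono_homologyMap_mor₁_iff _ hδ (-1) 0
          (by lia)).2 ((hGE _).eq_of_src _ _)
        epi_g := (DerivedCategory.HomologySequence.epi_homologyMap_mor₂_iff _ hδ 0 1
          (by lia)).2 ((hLE _).eq_of_tgt _ _) }
    exact ShortComplex.shortExact_of_iso ((S.map τ.T.ι).mapNatIso
      (DerivedCategory.singleFunctorCompHomologyFunctorIso A 0)) h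

end TorsionPair

namespace CochainComplex

/-- A morphism from a complex concentrated in degrees `≥ n` to a single complex in degree `n`
is injective on the homology in degree `n` if it is injective in degree `n`. -/
theorem mono_homologyMap_to_single {A : Type*} [Category* A] [Abelian A] {X : CochainComplex A ℤ}
    {n m : ℤ} (hn : m + 1 = n) (hX : IsZero (X.X m)) {Y : A}
    (φ : X ⟶ (HomologicalComplex.single A (ComplexShape.up ℤ) n).obj Y) [Mono (φ.f n)] :
    Mono (HomologicalComplex.homologyMap φ n) := by
  have h₁ : IsIso (X.homologyπ n) :=
    X.isIso_homologyπ m n (by simp [← hn]) (hX.eq_of_src _ _)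
  have h₂ : IsIso (((HomologicalComplex.single A (ComplexShape.up ℤ) n).obj Y).homologyπ n) :=
    HomologicalComplex.isIso_homologyπ _ m n (by simp [← hn])
      ((HomologicalComplex.isZero_single_obj_X _ _ _ _ (by lia)).eq_of_src _ _)
  have h₃ : Mono (HomologicalComplex.cyclesMap φ n) :=
    mono_of_mono_fac (HomologicalComplex.cyclesMap_i φ n)
  have h₄ : HomologicalComplex.homologyMap φ n = inv (X.homologyπ n) ≫
      HomologicalComplex.cyclesMap φ n ≫ HomologicalComplex.homologyπ _ n := by
    rw [← HomologicalComplex.homologyπ_naturality, IsIso.inv_hom_id_assoc]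
  rw [h₄]
  infer_instance

end CochainComplex

namespace TorsionPair

variable {A : Type u} [Category.{v} A] [Abelian A] {τ : TorsionPair A}
  [HasDerivedCategory.{w} A]

/-- Represent `M` by a complex starting in degree $-1$: then $H^{-1}(M)$ is a subobject of the first
term, and an embedding of that term into a torsion object is a map of complexes. -/
theorem IsTilting.exists_mono_homology (hτ : τ.IsTilting) (M : DerivedCategory A) [M.IsGE (-1)] :
    ∃ (Y : A) (_ : τ.T Y) (u : M ⟶ ((DerivedCategory.singleFunctor A 0).obj Y)⟦(1 : ℤ)⟧),
      Mono ((DerivedCategory.homologyFunctor A (-1)).map u) := by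
  obtain ⟨X, hX, ⟨e⟩⟩ := M.exists_iso_Q_obj_of_isGE (-1)
  have hX₂ : IsZero (X.X (-2)) := (CochainComplex.isStrictlyGE_iff _ _).1 hX _ (by lia)
  obtain ⟨Y, i, hY, hi⟩ := hτ (X.X (-1))
  let φ : X ⟶ (HomologicalComplex.single A (ComplexShape.up ℤ) (-1)).obj Y :=
    HomologicalComplex.mkHomToSingle i (fun j hj => by
      obtain rfl : j = -2 := by simp at hj; lia
      exact hX₂.eq_of_src _ _)
  have : Mono (φ.f (-1)) := by
    simp only [φ, HomologicalComplex.mkHomToSingle_f]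
    infer_instance
  have hφ := CochainComplex.mono_homologyMap_to_single (m := -2) (by lia) hX₂ φ
  have hφ' : Mono ((DerivedCategory.homologyFunctor A (-1)).map (DerivedCategory.Q.map φ)) :=
    ((MorphismProperty.monomorphisms A).arrow_mk_iso_iff
      (((Functor.mapArrowFunctor _ _).mapIso
        (DerivedCategory.homologyFunctorFactors A (-1))).app (Arrow.mk φ))).2 hφ
  let e' : DerivedCategory.Q.obj ((HomologicalComplex.single A (ComplexShape.up ℤ) (-1)).obj Y) ≅
      ((DerivedCategory.singleFunctor A 0).obj Y)⟦(1 : ℤ)⟧ :=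
    (DerivedCategory.singleFunctorIsoCompQ A (-1)).symm.app Y ≪≫
      (((DerivedCategory.singleFunctors A).shiftIso 1 (-1) 0 (by lia)).symm.app Y)
  refine ⟨Y, hY, e.hom ≫ DerivedCategory.Q.map φ ≫ e'.hom, ?_⟩
  rw [Functor.map_comp, Functor.map_comp]
  infer_instance

theorem IsTilting.exists_epi_toHeart (hτ : τ.IsTilting) (M : τ.Heart) :
    ∃ (X : τ.T.FullSubcategory) (p : τ.toHeart.obj X ⟶ M), Epi p := by
  have hM : M.1.IsGE (-1) := (DerivedCategory.isGE_iff _ _).2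
    (fun i hi => M.2.2.2 i (by lia) (by lia))
  obtain ⟨Y, hY, u, hu⟩ := hτ.exists_mono_homology M.1
  -- The fibre $E$ of `u` is the cover: injectivity on $H^{-1}$ kills $H^{-1}(E)$, and $H^0(E)$ is
  -- an extension of $H^0(M)$ by a quotient of $Y$, hence torsion.
  obtain ⟨E, a, p, hT⟩ := distinguished_cocone_triangle₂ u
  have hGE (i : ℤ) (hi : i < 0) : IsZero ((DerivedCategory.homologyFunctor A i).obj
      ((DerivedCategory.singleFunctor A 0).obj Y)) := DerivedCategory.isZero_of_isGE _ 0 i hi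
  have hLE (i : ℤ) (hi : 0 < i) : IsZero ((DerivedCategory.homologyFunctor A i).obj
      ((DerivedCategory.singleFunctor A 0).obj Y)) := DerivedCategory.isZero_of_isLE _ 0 i hi
  have hE₁ : IsZero ((DerivedCategory.homologyFunctor A (-1)).obj E) := by
    have h₁ : Mono ((DerivedCategory.homologyFunctor A (-1)).map p) :=
      (DerivedCategory.HomologySequence.mono_homologyMap_mor₂_iff _ hT (-1)).2
        ((hGE (-1) (by lia)).eq_of_src _ _)
    have h₂ : (DerivedCategory.homologyFunctor A (-1)).map p ≫
        (DerivedCategory.homologyFunctor A (-1)).map u = 0 :=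
      ((DerivedCategory.homologyFunctor A (-1)).map_comp p u).symm.trans
        ((congrArg _ (comp_distTriang_mor_zero₂₃ _ hT)).trans (Functor.map_zero _ _ _))
    rw [IsZero.iff_id_eq_zero, ← cancel_mono ((DerivedCategory.homologyFunctor A (-1)).map p),
      ← cancel_mono ((DerivedCategory.homologyFunctor A (-1)).map u)]
    simp [h₂]
  have hE₀ : τ.T ((DerivedCategory.homologyFunctor A 0).obj E) := by
    have h := DerivedCategory.HomologySequence.exact₂ _ hT 0
    have : Epi ((DerivedCategory.homologyFunctor A 0).map p) :=
      (DerivedCategory.HomologySequence.epi_homologyMap_mor₂_iff _ hT 0 1 (by lia)).2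
        ((hLE 1 (by lia)).eq_of_tgt _ _)
    exact @T_of_exact A _ _ τ _ h this
      (τ.T_of_iso ((DerivedCategory.singleFunctorCompHomologyFunctorIso A 0).symm.app Y) hY) M.2.1
  have hE : τ.heart E := ⟨hE₀, τ.F_of_isZero hE₁, fun i h₀ h₁ => by
    refine isZero_homology₂ _ hT i ?_ (M.2.2.2 i h₀ h₁)
    obtain hi | hi : 0 < i ∨ i < 0 := by lia
    · exact hLE i hi
    · exact hGE i hi⟩
  obtain ⟨X, ⟨e⟩⟩ := (τ.toHeart_essImage_iff ⟨E, hE⟩).2 hE₁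
  let a' : τ.toHeart.obj ⟨Y, hY⟩ ⟶ ⟨E, hE⟩ := ObjectProperty.homMk a
  let p' : (⟨E, hE⟩ : τ.Heart) ⟶ M := ObjectProperty.homMk p
  have h := τ.shortExact_of_distTriang (ShortComplex.mk a' p'
    (τ.heart.ι.map_injective (comp_distTriang_mor_zero₁₂ _ hT))) u hT
  have : Epi p' := h.epi_g
  exact ⟨X, e.hom ≫ p', epi_comp _ _⟩

theorem IsTilting.isResolving_toHeart (hτ : τ.IsTilting) : τ.toHeart.IsResolving where
  subobject _ _ f _ hN := τ.toHeart_essImage_of_mono f hN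
  exists_epi := hτ.exists_epi_toHeart

theorem IsTilting.acyclic_eq (hτ : τ.IsTilting) : τ.T.ι.acyclic = τ.toHeart.acyclic :=
  Functor.acyclic_eq_acyclic hτ.isCoresolving hτ.isResolving_toHeart τ.shortExact_map_toHeart_iff

end TorsionPair

/-! ### Stalk complexes and restriction to bounded derived categories -/

namespace CategoryTheory

section

variable {T C : Type*} [Category* T] [Category* C] [Preadditive T] [HasZeroObject T]
  [Abelian C] [HasDerivedCategory C] (F : T ⥤ C) [F.Additive]

/-- The compatibility of `Functor.toDerivedCategory` with the single functors. -/
noncomputable def Functor.singleCompToDerivedCategoryIso :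
    (HomologicalComplex.single T (ComplexShape.up ℤ) 0 ⋙ HomotopyCategory.quotient T _) ⋙
      F.toDerivedCategory ≅ F ⋙ DerivedCategory.singleFunctor C 0 :=
  Functor.isoWhiskerLeft (HomologicalComplex.single T (ComplexShape.up ℤ) 0 ⋙
      F.mapHomologicalComplex (ComplexShape.up ℤ)) (DerivedCategory.quotientCompQhIso C) ≪≫
    Functor.isoWhiskerRight
      (HomologicalComplex.singleMapHomologicalComplex F (ComplexShape.up ℤ) 0)
      DerivedCategory.Q ≪≫
    Functor.isoWhiskerLeft F (DerivedCategory.singleFunctorIsoCompQ C 0).symm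

end

section

variable {T C D : Type*} [Category* T] [Category* C] [Category* D] [Preadditive T]
  [Abelian C] [Abelian D] [HasDerivedCategory C] [HasDerivedCategory D]
  {F : T ⥤ C} [F.Additive] {G : T ⥤ D} [G.Additive]
  {Φ : DerivedCategory D ⥤ DerivedCategory C} [Φ.Full] [Φ.Faithful]

/-- Up to `Φ`, the same bounded below complexes in `T` describe both sides. -/
theorem Functor.HasResolutions.plus_obj_iff (hF : F.HasResolutions) (hG : G.HasResolutions)
    (e : G.toDerivedCategory ⋙ Φ ≅ F.toDerivedCategory) (X : DerivedCategory D) :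
    DerivedCategory.TStructure.t.plus (Φ.obj X) ↔ DerivedCategory.TStructure.t.plus X := by
  rw [hF.plus_iff, hG.plus_iff]
  exact ⟨fun ⟨n, L, hL, ⟨e'⟩⟩ => ⟨n, L, hL, ⟨Φ.preimageIso (e.app _ ≪≫ e')⟩⟩,
    fun ⟨n, L, hL, ⟨e'⟩⟩ => ⟨n, L, hL, ⟨e.symm.app _ ≪≫ Φ.mapIso e'⟩⟩⟩

theorem Functor.HasResolutions.minus_obj_iff (hF : F.HasResolutions) (hG : G.HasResolutions)
    (e : G.toDerivedCategory ⋙ Φ ≅ F.toDerivedCategory) (X : DerivedCategory D) :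
    DerivedCategory.TStructure.t.minus (Φ.obj X) ↔ DerivedCategory.TStructure.t.minus X := by
  rw [hF.minus_iff, hG.minus_iff]
  exact ⟨fun ⟨n, L, hL, ⟨e'⟩⟩ => ⟨n, L, hL, ⟨Φ.preimageIso (e.app _ ≪≫ e')⟩⟩,
    fun ⟨n, L, hL, ⟨e'⟩⟩ => ⟨n, L, hL, ⟨e.symm.app _ ≪≫ Φ.mapIso e'⟩⟩⟩

end

section

variable {B D₁ D₂ : Type*} [Category* B] [Category* D₁] [Category* D₂]
  [HasZeroObject D₁] [HasShift D₁ ℤ] [Preadditive D₁] [∀ (n : ℤ), (shiftFunctor D₁ n).Additive]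
  [Pretriangulated D₁]
  [HasZeroObject D₂] [HasShift D₂ ℤ] [Preadditive D₂] [∀ (n : ℤ), (shiftFunctor D₂ n).Additive]
  [Pretriangulated D₂]

/-- A triangle equivalence restricts to triangulated subcategories which correspond to each
other. -/
theorem exists_triangulated_equivalence_fullSubcategory (Φ : D₁ ⥤ D₂) [Φ.CommShift ℤ]
    [Φ.IsEquivalence] [Φ.IsTriangulated] (P₁ : ObjectProperty D₁) (P₂ : ObjectProperty D₂)
    [P₁.IsTriangulated] [P₂.IsTriangulated] [P₂.IsClosedUnderIsomorphisms]
    (hP : ∀ X, P₂ (Φ.obj X) ↔ P₁ X) (S : B ⥤ D₁) (hS : ∀ X, P₁ (S.obj X)) (ι : B ⥤ D₂)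
    (e : S ⋙ Φ ≅ ι) :
    ∃ (Ψ : P₁.FullSubcategory ⥤ P₂.FullSubcategory) (_ : Ψ.CommShift ℤ),
      Ψ.IsEquivalence ∧ Ψ.IsTriangulated ∧ Nonempty (Ψ ⋙ P₂.ι ≅ P₁.ι ⋙ Φ) ∧
      Nonempty (P₁.lift S hS ⋙ Ψ ⋙ P₂.ι ≅ ι) := by
  let Ψ : P₁.FullSubcategory ⥤ P₂.FullSubcategory :=
    P₂.lift (P₁.ι ⋙ Φ) (fun X => (hP _).2 X.2)
  let hΨ : Ψ.CommShift ℤ := inferInstanceAs ((P₂.lift (P₁.ι ⋙ Φ) _).CommShift ℤ)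
  have : Ψ.Full := inferInstanceAs (P₂.lift (P₁.ι ⋙ Φ) _).Full
  have : Ψ.Faithful := inferInstanceAs (P₂.lift (P₁.ι ⋙ Φ) _).Faithful
  have : Ψ.EssSurj := ⟨fun Y => by
    have e := Φ.objObjPreimageIso Y.1
    exact ⟨⟨Φ.objPreimage Y.1, (hP _).1 (P₂.prop_of_iso e.symm Y.2)⟩,
      ⟨P₂.fullyFaithfulι.preimageIso e⟩⟩⟩
  exact ⟨Ψ, hΨ, {}, inferInstanceAs (P₂.lift (P₁.ι ⋙ Φ) _).IsTriangulated, ⟨Iso.refl _⟩, ⟨e⟩⟩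

end

end CategoryTheory

/-! ### The derived equivalence -/

namespace TorsionPair

variable {A : Type u} [Category.{v} A] [Abelian A] {τ : TorsionPair A}
  [HasDerivedCategory.{w} A]

theorem heart_ι_mapsShortExactToDistTriang : τ.heart.ι.MapsShortExactToDistTriang :=
  τ.exists_distTriang_of_shortExact

theorem heart_hom_shift_one_eq_zero ⦃X Y : τ.Heart⦄
    (f : (τ.heart.ι.obj X)⟦(1 : ℤ)⟧ ⟶ τ.heart.ι.obj Y) : f = 0 :=
  AbelianSubcategory.eq_zero_of_hom_shift_pos (heart_hom_shift_eq_zero _ _ τ.heart_eq) f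
    (by lia)

variable [HasDerivedCategory.{w'} τ.Heart]

theorem IsTilting.exists_equivalence (hτ : τ.IsTilting) :
    ∃ (Φ : DerivedCategory τ.Heart ⥤ DerivedCategory A) (_ : Φ.CommShift ℤ),
      Φ.IsEquivalence ∧ Φ.IsTriangulated ∧
      Nonempty (τ.toHeart.toDerivedCategory ⋙ Φ ≅ τ.T.ι.toDerivedCategory) := by
  have := hτ.isCoresolving.isLocalization
  have := hτ.isResolving_toHeart.isLocalization
  rw [← hτ.acyclic_eq] at this
  exact exists_triangulated_equivalence_of_isLocalization _ _ τ.T.ι.acyclic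

theorem IsTilting.nonempty_singleFunctor_comp_iso (hτ : τ.IsTilting)
    (Φ : DerivedCategory τ.Heart ⥤ DerivedCategory A) [Φ.CommShift ℤ] [Φ.IsTriangulated]
    (e : τ.toHeart.toDerivedCategory ⋙ Φ ≅ τ.T.ι.toDerivedCategory) :
    Nonempty (DerivedCategory.singleFunctor τ.Heart 0 ⋙ Φ ≅ τ.heart.ι) := by
  refine hτ.isResolving_toHeart.nonempty_iso
    (fun S hS => ⟨_, Φ.map_distinguished _ hS.singleTriangle_distinguished⟩)
    heart_ι_mapsShortExactToDistTriang heart_hom_shift_one_eq_zero ?_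
  exact Functor.isoWhiskerRight τ.toHeart.singleCompToDerivedCategoryIso.symm Φ ≪≫
    Functor.isoWhiskerLeft (HomologicalComplex.single _ (ComplexShape.up ℤ) 0 ⋙
      HomotopyCategory.quotient _ _) e ≪≫ τ.T.ι.singleCompToDerivedCategoryIso ≪≫
    τ.toHeartCompιIso.symm

end TorsionPair

theorem mainTheorem1 {A : Type u} [Category.{v} A] [Abelian A] [HasDerivedCategory.{w} A]
    (τ : TorsionPair A) (hτ : τ.IsTilting) [HasDerivedCategory.{w'} τ.Heart] :
    ∃ (Φ : DerivedCategory τ.Heart ⥤ DerivedCategory A) (_ : Φ.CommShift ℤ),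
      Φ.IsEquivalence ∧ Φ.IsTriangulated ∧
      Nonempty (DerivedCategory.singleFunctor τ.Heart 0 ⋙ Φ ≅ τ.heart.ι) ∧
      (∃ (Φp : DerivedCategory.Plus τ.Heart ⥤ DerivedCategory.Plus A) (_ : Φp.CommShift ℤ),
        Φp.IsEquivalence ∧ Φp.IsTriangulated ∧
        Nonempty (Φp ⋙ DerivedCategory.Plus.ι ≅ DerivedCategory.Plus.ι ⋙ Φ) ∧
        Nonempty (DerivedCategory.toPlus τ.Heart ⋙ Φp ⋙ DerivedCategory.Plus.ι ≅ τ.heart.ι)) ∧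
      (∃ (Φm : DerivedCategory.Minus τ.Heart ⥤ DerivedCategory.Minus A) (_ : Φm.CommShift ℤ),
        Φm.IsEquivalence ∧ Φm.IsTriangulated ∧
        Nonempty (Φm ⋙ DerivedCategory.Minus.ι ≅ DerivedCategory.Minus.ι ⋙ Φ) ∧
        Nonempty (DerivedCategory.toMinus τ.Heart ⋙ Φm ⋙ DerivedCategory.Minus.ι ≅ τ.heart.ι)) ∧
      (∃ (Φb : DerivedCategory.Bounded τ.Heart ⥤ DerivedCategory.Bounded A) (_ : Φb.CommShift ℤ),
        Φb.IsEquivalence ∧ Φb.IsTriangulated ∧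
        Nonempty (Φb ⋙ DerivedCategory.Bounded.ι ≅ DerivedCategory.Bounded.ι ⋙ Φ) ∧
        Nonempty (DerivedCategory.toBounded τ.Heart ⋙ Φb ⋙ DerivedCategory.Bounded.ι ≅
          τ.heart.ι)) := by
  obtain ⟨Φ, hΦ, hΦ₁, hΦ₂, ⟨e⟩⟩ := hτ.exists_equivalence
  obtain ⟨e'⟩ := hτ.nonempty_singleFunctor_comp_iso Φ e
  have hp := hτ.isCoresolving.hasResolutions.plus_obj_iff hτ.isResolving_toHeart.hasResolutions e
  have hm := hτ.isCoresolving.hasResolutions.minus_obj_iff hτ.isResolving_toHeart.hasResolutions e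
  exact ⟨Φ, hΦ, hΦ₁, hΦ₂, ⟨e'⟩,
    exists_triangulated_equivalence_fullSubcategory Φ _ _ hp _ _ _ e',
    exists_triangulated_equivalence_fullSubcategory Φ _ _ hm _ _ _ e',
    exists_triangulated_equivalence_fullSubcategory Φ _ _
      -- Bounded means both bounded below and bounded above.
      (fun X => and_congr (hp X) (hm X)) _ _ _ e'⟩
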